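/- All rings are associative with $1$; let $R$ be a ring. For a left Gabriel filter $\mathcal F_l$ (of left ideals) and a right Gabriel filter $\mathcal F_r$ (of right ideals) of $R$, the induced symmetric filter ${}_l\mathcal F_r$ consists of the right ideals of $R\otimes_{\mathbb Z}R^{op}$ that contain $J\otimes R^{op}+R\otimes I$ (the sum of the images) for some $I\in\mathcal F_l$, $J\in\mathcal F_r$; it is a Gabriel filter. $R$-bimodules are regarded as right $R\otimes_{\mathbb Z} R^{op}$-modules via $x(s\otimes r)=rxs$; ${}_lt_r(M)$ is the torsion submodule, consisting of the $x$ whose annihilator lies in ${}_l\mathcal F_r$. The symmetric module of quotients of a bimodule $M$ is ${}_lM_r=\varinjlim_{K\in{}_l\mathcal F_r}\mathrm{Hom}(K,M/{}_lt_r(M))$, with canonical map $q:M\to{}_lM_r$; for $M=R$ it is a ring, the symmetric ring of quotients ${}_lR_r$. The symmetric torsion theory is called faithful if it is induced by faithful left and right theories (those for which $R$ is torsion-free as a left, respectively right, module). It is called differential if for every derivation $\delta$ of $R$ and every $K\in{}_l\mathcal F_r$ there is $L\in{}_l\mathcal F_r$ with $\bar\delta(L)\subseteq K$, where $\bar\delta(r\otimes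 s)=\delta(r)\otimes s+r\otimes\delta(s)$. Symmetric Lambek theory: $\mathcal F_l,\mathcal F_r$ are the filters of dense left and right ideals, and the ring of quotients is $Q^\sigma_{max}(R)$. Symmetric Goldie theory: induced by the left and right theories whose torsion-free modules are the nonsingular ones, with ring of quotients $Q^\sigma_{Gold}(R)$. A ring homomorphism $f:R\to S$ makes $S$ a perfect symmetric ring of quotients if $\mathcal F_l=\{I: Sf(I)=S\}$ and $\mathcal F_r=\{J: f(J)S=S\}$ are Gabriel filters and there is a ring isomorphism $S\cong{}_lR_r$ carrying $f$ to $q$; then ${}_l\mathcal F_r$ is called perfect. The total symmetric ring of quotients $Q^\sigma_{tot}(R)$ is the largest perfect symmetric ring of quotients containing $R$, i.e. the one whose filters $\mathcal F_l$, $\mathcal F_r$ are the largest among those of all faithful perfect symmetric theories; the corresponding theory is called the maximal perfect one. If $R$ is left and right Ore, the classical torsion theory is induced by the one-sided theories in which $x$ is torsion if and only if $tx=0$ (respectively $xt=0$) for some regular $t$; its symmetric ring of quotients is $Q_{cl}(R)$. Let $\delta$ be a derivation of $R$, $M$ an $R$-bimodule, and $d:M\to M$ a $\delta$-derivation, i.e.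 $d$ is additive with $d(rx)=\delta(r)x+r\,d(x)$ and $d(xr)=d(x)r+x\delta(r)$. An extension of $d$ to ${}_lM_r$ is a $\delta$-derivation $D$ of ${}_lM_r$ with $Dq=qd$; an extension of $\delta$ to ${}_lR_r$ is a ring derivation $D$ with $Dq=q\delta$. For two symmetric theories, we say that the extensions to the corresponding modules (or rings) of quotients agree if the first symmetric filter is contained in the second one, the extensions $D_1$ and $D_2$ to the first and second module (ring) of quotients both exist and are unique, and $q_{12}D_1=D_2q_{12}$ for the canonical map $q_{12}$ from the first module (ring) of quotients to the second one. Then $Q^\sigma_{tot}(R)$ exists, and: 1. The extension of $\delta$ to the symmetric ring of quotients of any faithful symmetric torsion theory agrees with the extension to $Q^\sigma_{max}(R)$. In particular, the extensions to $Q^\sigma_{tot}(R)$ and $Q^\sigma_{max}(R)$ agree. 2. The extension of $d$ to the symmetric module of quotients of $M$ for any differential faithful symmetric torsion theory agrees with the extension to the one for the symmetric Lambek theory. In particular, the extensions for the maximal perfect symmetric theory and the symmetric Lambek theory agree. 3. If $R$ is left and right Ore, then $Q_{cl}(R)$ is isomorphic, as a ring under $R$, to the Ore localization of $R$ at its regular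 elements, and the extension of $\delta$ to $Q_{cl}(R)$ agrees with the extensions to $Q^\sigma_{max}(R)$ and to $Q^\sigma_{tot}(R)$. 4. The extensions of $\delta$ to $Q^\sigma_{max}(R)$ and $Q^\sigma_{Gold}(R)$ agree. Moreover, the extension of $\delta$ to the symmetric ring of quotients of any faithful symmetric torsion theory agrees with the extension to $Q^\sigma_{Gold}(R)$. -/

import Mathlib

open scoped TensorProduct nonZeroDivisors
open MulOpposite

universe u v w

noncomputable section

/-! ### Gabriel filters

All ideals and modules are left ones. Right `R`-modules are treated, as everywhere in Mathlib, as
(left) modules over `Rᵐᵒᵖ`, so that right ideals of `R` are the elements of `Ideal Rᵐᵒᵖ`. -/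

/-- The left ideal `(I : a) = {b | b * a ∈ I}`. -/
def leftColon {A : Type u} [Ring A] (I : Ideal A) (a : A) : Ideal A :=
  Submodule.comap (LinearMap.toSpanSingleton A A a) I

@[simp] theorem mem_leftColon {A : Type u} [Ring A] {I : Ideal A} {a b : A} :
    b ∈ leftColon I a ↔ b * a ∈ I := by
  simp [leftColon]

/-- The annihilator `{a | a • x = 0}` of an element of a module. -/
def elemAnn (A : Type u) [Ring A] {M : Type v} [AddCommGroup M] [Module A M] (x : M) : Ideal A :=
  LinearMap.ker (LinearMap.toSpanSingleton A M x)

@[simp] theorem mem_elemAnn {A : Type u} [Ring A] {M : Type v} [AddCommGroup M] [Module A M]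
    {x : M} {a : A} : a ∈ elemAnn A x ↔ a • x = 0 := by
  simp [elemAnn]

/-- A Gabriel filter of left ideals of a ring; these are the filters that determine the hereditary
torsion theories of `A`-modules. -/
@[ext] structure GabrielFilter (A : Type u) [Ring A] where
  ideals : Set (Ideal A)
  top_mem : ⊤ ∈ ideals
  mem_of_le : ∀ {I J : Ideal A}, I ∈ ideals → I ≤ J → J ∈ ideals
  inf_mem : ∀ {I J : Ideal A}, I ∈ ideals → J ∈ ideals → I ⊓ J ∈ ideals
  colon_mem : ∀ {I : Ideal A}, I ∈ ideals → ∀ a : A, leftColon I a ∈ ideals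
  mem_of_colon : ∀ {I J : Ideal A}, J ∈ ideals → (∀ a ∈ J, leftColon I a ∈ ideals) → I ∈ ideals

namespace GabrielFilter

variable {A : Type u} [Ring A]

instance : Membership (Ideal A) (GabrielFilter A) := ⟨fun F I => I ∈ F.ideals⟩

instance : LE (GabrielFilter A) := ⟨fun F G => ∀ I : Ideal A, I ∈ F → I ∈ G⟩

/-- The torsion submodule `t(M)`: all `x` whose annihilator belongs to the filter. -/
def torsion (F : GabrielFilter A) (M : Type v) [AddCommGroup M] [Module A M] : Submodule A M where
  carrier := {x | elemAnn A x ∈ F}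
  zero_mem' := F.mem_of_le F.top_mem (fun a _ => by simp)
  add_mem' := fun {x y} hx hy => F.mem_of_le (F.inf_mem hx hy) (fun a ha => by
    obtain ⟨h1, h2⟩ := ha
    have h1' := mem_elemAnn.1 h1
    have h2' := mem_elemAnn.1 h2
    simp [h1', h2'])
  smul_mem' := fun c x hx => F.mem_of_le (F.colon_mem hx c) (fun a ha => by
    simpa [mul_smul] using ha)

theorem mem_torsion {F : GabrielFilter A} {M : Type v} [AddCommGroup M] [Module A M] {x : M} :
    x ∈ F.torsion M ↔ elemAnn A x ∈ F := Iff.rfl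

/-- The torsion theory is faithful: `t(A) = 0`. -/
def IsFaithful (F : GabrielFilter A) : Prop := F.torsion A = ⊥

/-- The torsion-free quotient `M / t(M)`. -/
abbrev TFQuot (F : GabrielFilter A) (M : Type v) [AddCommGroup M] [Module A M] : Type v :=
  M ⧸ F.torsion M

theorem tfQuot_eq_zero {F : GabrielFilter A} {M : Type v} [AddCommGroup M] [Module A M]
    {x : F.TFQuot M} {K : Ideal A} (hK : K ∈ F) (h : ∀ k ∈ K, k • x = 0) : x = 0 := by
  obtain ⟨m, rfl⟩ := Submodule.Quotient.mk_surjective _ x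
  rw [Submodule.Quotient.mk_eq_zero, mem_torsion]
  refine F.mem_of_colon hK (fun k hk => ?_)
  have := h k hk
  rw [← Submodule.Quotient.mk_smul, Submodule.Quotient.mk_eq_zero, mem_torsion] at this
  refine F.mem_of_le this (fun a ha => ?_)
  simpa [mul_smul] using ha

/-! ### Modules of quotients -/

/-- The filter as an index set for direct limits (smaller ideals are larger indices). -/
structure Index (F : GabrielFilter A) : Type u where
  ideal : Ideal A
  mem : ideal ∈ F

instance (F : GabrielFilter A) : Preorder F.Index where
  le K L := L.ideal ≤ K.ideal
  le_refl _ := le_rfl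
  le_trans _ _ _ h h' := h'.trans h

/-- The index belonging to an ideal of the filter. -/
abbrev idx (F : GabrielFilter A) (K : Ideal A) (hK : K ∈ F) : F.Index := ⟨K, hK⟩

instance (F : GabrielFilter A) : Nonempty F.Index := ⟨F.idx ⊤ F.top_mem⟩

instance (F : GabrielFilter A) : IsDirectedOrder F.Index :=
  ⟨fun K L => ⟨F.idx (K.ideal ⊓ L.ideal) (F.inf_mem K.mem L.mem),
    show K.ideal ⊓ L.ideal ≤ K.ideal from inf_le_left,
    show K.ideal ⊓ L.ideal ≤ L.ideal from inf_le_right⟩⟩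

section

variable (F : GabrielFilter A) (M : Type v) [AddCommGroup M] [Module A M]

/-- `Hom(K, M / t(M))` for `K` in the filter. -/
abbrev HomTF (K : F.Index) : Type (max u v) := K.ideal →ₗ[A] F.TFQuot M

/-- Restriction `Hom(K, M / t(M)) → Hom(L, M / t(M))` for `L ⊆ K`. -/
def restr (K L : F.Index) (h : K ≤ L) : F.HomTF M K →+ F.HomTF M L where
  toFun φ := φ ∘ₗ Submodule.inclusion (show L.ideal ≤ K.ideal from h)
  map_zero' := rfl
  map_add' _ _ := rfl

instance : DirectedSystem (F.HomTF M) (fun K L h => F.restr M K L h) where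
  map_self _ _ := rfl
  map_map _ _ _ _ _ _ := rfl

open Classical in
/-- The module of quotients: the direct limit of `Hom(K, M / t(M))` over all `K` in the filter. -/
def ModQ : Type (max u v) := AddCommGroup.DirectLimit (F.HomTF M) (F.restr M)

open Classical in
instance : AddCommGroup (F.ModQ M) :=
  inferInstanceAs (AddCommGroup (AddCommGroup.DirectLimit (F.HomTF M) (F.restr M)))

open Classical in
/-- The class in the module of quotients of a homomorphism `φ : K → M / t(M)`. -/
def germ (K : F.Index) : F.HomTF M K →+ F.ModQ M :=
  AddCommGroup.DirectLimit.of (F.HomTF M) (F.restr M) K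

end

section

variable {F : GabrielFilter A} {M : Type v} [AddCommGroup M] [Module A M]

theorem exists_germ (x : F.ModQ M) : ∃ (K : F.Index) (φ : F.HomTF M K), F.germ M K φ = x := by
  classical
  exact AddCommGroup.DirectLimit.induction_on
    (C := fun x : F.ModQ M => ∃ (K : F.Index) (φ : F.HomTF M K), F.germ M K φ = x)
    x (fun K φ => ⟨K, φ, rfl⟩)

theorem germ_restr (K L : F.Index) (h : K ≤ L) (φ : F.HomTF M K) :
    F.germ M L (F.restr M K L h φ) = F.germ M K φ := by
  classical
  exact AddCommGroup.DirectLimit.of_f h φ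

/-- Homomorphisms that agree on an ideal in the filter have the same class. -/
theorem germ_eq (K L : F.Index) (φ : F.HomTF M K) (ψ : F.HomTF M L) (N : Ideal A) (hN : N ∈ F)
    (h : ∀ a ∈ N, ∀ (h1 : a ∈ K.ideal) (h2 : a ∈ L.ideal), φ ⟨a, h1⟩ = ψ ⟨a, h2⟩) :
    F.germ M K φ = F.germ M L ψ := by
  have hP : N ⊓ (K.ideal ⊓ L.ideal) ∈ F := F.inf_mem hN (F.inf_mem K.mem L.mem)
  set P := F.idx _ hP with hPdef
  have hK : K ≤ P := show N ⊓ (K.ideal ⊓ L.ideal) ≤ K.ideal from inf_le_right.trans inf_le_left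
  have hL : L ≤ P := show N ⊓ (K.ideal ⊓ L.ideal) ≤ L.ideal from inf_le_right.trans inf_le_right
  rw [← germ_restr K P hK, ← germ_restr L P hL]
  congr 1
  ext ⟨a, ha⟩
  exact h a ha.1 ha.2.1 ha.2.2

theorem germ_zero_exact (K : F.Index) (φ : F.HomTF M K) (h : F.germ M K φ = 0) : φ = 0 := by
  classical
  obtain ⟨L, hL, h0⟩ := AddCommGroup.DirectLimit.of.zero_exact K φ h
  ext ⟨a, ha⟩
  refine tfQuot_eq_zero (F.colon_mem L.mem a) (fun b hb => ?_)
  rw [← map_smul]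
  exact LinearMap.congr_fun h0 ⟨b * a, by simpa using hb⟩

end

section

variable (F : GabrielFilter A) (M : Type v) [AddCommGroup M] [Module A M]

/-- `(a • φ)(b) = φ (b * a)` for `φ : K → M / t(M)` and `b ∈ (K : a)`. -/
def smulHom (a : A) (K : F.Index) :
    F.HomTF M K →+ F.HomTF M (F.idx (leftColon K.ideal a) (F.colon_mem K.mem a)) where
  toFun φ := φ ∘ₗ ((LinearMap.toSpanSingleton A A a).restrict (fun _ hb => hb))
  map_zero' := rfl
  map_add' _ _ := rfl

theorem smulHom_apply (a : A) (K : F.Index) (φ : F.HomTF M K) (b : A) (h : b ∈ leftColon K.ideal a) :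
    F.smulHom M a K φ ⟨b, h⟩ = φ ⟨b * a, by simpa using h⟩ := rfl

open Classical in
/-- Multiplication by `a` on the module of quotients. -/
def smulQ (a : A) : F.ModQ M →+ F.ModQ M :=
  AddCommGroup.DirectLimit.lift (F.HomTF M) (F.restr M) (F.ModQ M)
    (fun K => (F.germ M _).comp (F.smulHom M a K))
    (fun K L h φ => by
      refine germ_eq _ _ _ _ ⊤ F.top_mem (fun b _ h1 h2 => ?_)
      rfl)

instance : SMul A (F.ModQ M) := ⟨fun a x => F.smulQ M a x⟩

theorem smul_germ (a : A) (K : F.Index) (φ : F.HomTF M K) :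
    a • F.germ M K φ = F.germ M _ (F.smulHom M a K φ) := by
  classical
  exact AddCommGroup.DirectLimit.lift_of _ _ _ K φ

instance : Module A (F.ModQ M) where
  one_smul x := by
    obtain ⟨K, φ, rfl⟩ := exists_germ x
    rw [smul_germ]
    refine germ_eq _ _ _ _ ⊤ F.top_mem (fun b _ h1 h2 => ?_)
    rw [smulHom_apply]
    simp
  mul_smul a b x := by
    obtain ⟨K, φ, rfl⟩ := exists_germ x
    rw [smul_germ, smul_germ, smul_germ]
    refine germ_eq _ _ _ _ ⊤ F.top_mem (fun c _ h1 h2 => ?_)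
    rw [smulHom_apply, smulHom_apply, smulHom_apply]
    simp [mul_assoc]
  smul_zero a := map_zero (F.smulQ M a)
  smul_add a := map_add (F.smulQ M a)
  add_smul a b x := by
    obtain ⟨K, φ, rfl⟩ := exists_germ x
    rw [smul_germ, smul_germ, smul_germ]
    set L := F.idx (leftColon K.ideal a ⊓ leftColon K.ideal b)
      (F.inf_mem (F.colon_mem K.mem a) (F.colon_mem K.mem b)) with hL
    rw [← germ_restr _ L (show leftColon K.ideal a ⊓ leftColon K.ideal b ≤ _ from inf_le_left)
        (F.smulHom M a K φ),
      ← germ_restr _ L (show leftColon K.ideal a ⊓ leftColon K.ideal b ≤ _ from inf_le_right)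
        (F.smulHom M b K φ), ← map_add]
    refine germ_eq _ _ _ _ ⊤ F.top_mem (fun c _ h1 h2 => ?_)
    rw [smulHom_apply]
    have e : (⟨c * (a + b), by simpa using h1⟩ : K.ideal) =
        ⟨c * a, by simpa using h2.1⟩ + ⟨c * b, by simpa using h2.2⟩ := by
      ext; simp [mul_add]
    rw [e, map_add]
    rfl
  zero_smul x := by
    obtain ⟨K, φ, rfl⟩ := exists_germ x
    rw [smul_germ, ← map_zero (F.germ M K)]
    refine germ_eq _ _ _ _ ⊤ F.top_mem (fun b _ h1 h2 => ?_)
    rw [smulHom_apply]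
    have e : (⟨b * 0, by simp⟩ : K.ideal) = 0 := by ext; simp
    rw [e, map_zero]
    rfl

/-- The canonical map `q : M → M_F`, sending `m` to the class of `a ↦ a • m + t(M)`. -/
def toModQ : M →ₗ[A] F.ModQ M where
  toFun m := F.germ M (F.idx ⊤ F.top_mem)
    (LinearMap.toSpanSingleton A (F.TFQuot M) (Submodule.Quotient.mk m) ∘ₗ Submodule.subtype _)
  map_add' m n := by
    rw [← map_add]
    congr 1
    ext a
    simp
  map_smul' a m := by
    rw [RingHom.id_apply, smul_germ]
    refine germ_eq _ _ _ _ ⊤ F.top_mem (fun b _ h1 h2 => ?_)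
    rw [smulHom_apply]
    simp [mul_smul]

end

section

variable {F : GabrielFilter A} {M : Type v} [AddCommGroup M] [Module A M]

theorem smul_germ_of_mem (K : F.Index) (φ : F.HomTF M K) (k : A) (hk : k ∈ K.ideal) (m : M)
    (hm : φ ⟨k, hk⟩ = Submodule.Quotient.mk m) : k • F.germ M K φ = F.toModQ M m := by
  rw [smul_germ]
  refine germ_eq _ _ _ _ ⊤ F.top_mem (fun b _ h1 h2 => ?_)
  rw [smulHom_apply]
  have e : (⟨b * k, by simpa using h1⟩ : K.ideal) = b • ⟨k, hk⟩ := rfl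
  rw [e, map_smul, hm]
  rfl

theorem toModQ_eq_zero_iff (m : M) : F.toModQ M m = 0 ↔ m ∈ F.torsion M := by
  constructor
  · intro h
    have := germ_zero_exact _ _ h
    have h1 := LinearMap.congr_fun this ⟨1, trivial⟩
    simpa using h1
  · intro h
    have h0 : (Submodule.Quotient.mk m : F.TFQuot M) = 0 :=
      (Submodule.Quotient.mk_eq_zero _).2 h
    change F.germ M _ _ = 0
    rw [h0]
    simp

/-- Every element of the module of quotients is moved into the image of `M` by an ideal of the
filter. -/
theorem exists_smul_mem (x : F.ModQ M) : ∃ K ∈ F, ∀ k ∈ K, ∃ m, k • x = F.toModQ M m := by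
  obtain ⟨K, φ, rfl⟩ := exists_germ x
  refine ⟨K.ideal, K.mem, fun k hk => ?_⟩
  obtain ⟨m, hm⟩ := Submodule.Quotient.mk_surjective _ (φ ⟨k, hk⟩)
  exact ⟨m, smul_germ_of_mem K φ k hk m hm.symm⟩

/-- The module of quotients is torsion-free. -/
theorem modQ_eq_zero {x : F.ModQ M} {K : Ideal A} (hK : K ∈ F) (h : ∀ k ∈ K, k • x = 0) :
    x = 0 := by
  obtain ⟨L, φ, rfl⟩ := exists_germ x
  rw [← map_zero (F.germ M L)]
  refine germ_eq _ _ _ _ K hK (fun a ha h1 h2 => ?_)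
  obtain ⟨m, hm⟩ := Submodule.Quotient.mk_surjective _ (φ ⟨a, h1⟩)
  have := smul_germ_of_mem L φ a h1 m hm.symm
  rw [h a ha] at this
  rw [← hm, LinearMap.zero_apply, Submodule.Quotient.mk_eq_zero]
  exact (toModQ_eq_zero_iff m).1 this.symm

theorem modQ_ext {x y : F.ModQ M} {K : Ideal A} (hK : K ∈ F) (h : ∀ k ∈ K, k • x = k • y) :
    x = y :=
  sub_eq_zero.1 (modQ_eq_zero hK (fun k hk => by rw [smul_sub, h k hk, sub_self]))

/-- A single-valued submodule of `A × M_F` whose domain contains an ideal of the filter is given by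
an element of `M_F`. -/
theorem exists_of_graph (Γ : Submodule A (A × F.ModQ M)) (hΓ : ∀ n, (0, n) ∈ Γ → n = 0)
    (K : Ideal A) (hK : K ∈ F) (hKΓ : ∀ k ∈ K, ∃ n, (k, n) ∈ Γ) :
    ∃ x : F.ModQ M, ∀ a n, (a, n) ∈ Γ → a • x = n := by
  have huniq : ∀ a n n', (a, n) ∈ Γ → (a, n') ∈ Γ → n = n' := by
    intro a n n' h h'
    have := Γ.sub_mem h h'
    rw [Prod.mk_sub_mk, sub_self] at this
    exact sub_eq_zero.1 (hΓ _ this)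
  let L : Ideal A :=
    { carrier := {a | ∃ m, (a, F.toModQ M m) ∈ Γ}
      zero_mem' := ⟨0, by rw [map_zero]; exact Γ.zero_mem⟩
      add_mem' := by
        rintro a b ⟨m, hm⟩ ⟨n, hn⟩
        exact ⟨m + n, by rw [map_add]; exact Γ.add_mem hm hn⟩
      smul_mem' := by
        rintro c a ⟨m, hm⟩
        exact ⟨c • m, by rw [map_smul]; exact Γ.smul_mem c hm⟩ }
  have hL : L ∈ F := by
    refine F.mem_of_colon hK (fun k hk => ?_)
    obtain ⟨n, hn⟩ := hKΓ k hk
    obtain ⟨N, hN, h⟩ := exists_smul_mem n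
    refine F.mem_of_le hN (fun b hb => ?_)
    obtain ⟨m, hm⟩ := h b hb
    rw [mem_leftColon]
    refine ⟨m, ?_⟩
    rw [← hm]
    exact Γ.smul_mem b hn
  have hq : ∀ m m', F.toModQ M m = F.toModQ M m' →
      (Submodule.Quotient.mk m : F.TFQuot M) = Submodule.Quotient.mk m' := by
    intro m m' h
    rw [Submodule.Quotient.eq, ← toModQ_eq_zero_iff, map_sub, h, sub_self]
  choose m hm using fun a : L => a.2
  let φ : L →ₗ[A] F.TFQuot M :=
    { toFun := fun a => Submodule.Quotient.mk (m a)
      map_add' := fun a b => by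
        rw [← Submodule.Quotient.mk_add]
        refine hq _ _ (huniq _ _ _ (hm (a + b)) ?_)
        rw [map_add]
        exact Γ.add_mem (hm a) (hm b)
      map_smul' := fun c a => by
        rw [RingHom.id_apply, ← Submodule.Quotient.mk_smul]
        refine hq _ _ (huniq _ _ _ (hm (c • a)) ?_)
        rw [map_smul]
        exact Γ.smul_mem c (hm a) }
  refine ⟨F.germ M (F.idx L hL) φ, fun a n han => ?_⟩
  refine modQ_ext (F.colon_mem hL a) (fun b hb => ?_)
  have hb' : b * a ∈ L := by simpa using hb
  rw [← mul_smul, smul_germ_of_mem (F.idx L hL) φ (b * a) hb' (m ⟨b * a, hb'⟩) rfl]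
  exact huniq _ _ _ (hm ⟨b * a, hb'⟩) (Γ.smul_mem b han)

end

section

variable {F G : GabrielFilter A} (M : Type v) [AddCommGroup M] [Module A M]

/-- The projection `M / t_F(M) → M / t_G(M)` for `F ⊆ G`. -/
def tfQuotMap (h : F ≤ G) : F.TFQuot M →ₗ[A] G.TFQuot M :=
  Submodule.mapQ (F.torsion M) (G.torsion M) LinearMap.id (fun x hx => h (elemAnn A x) hx)

open Classical in
/-- The canonical map `M_F → M_G` for `F ⊆ G`, sending the class of `φ : K → M / t_F(M)` to the
class of `K → M / t_F(M) → M / t_G(M)`. -/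
def modQMap (h : F ≤ G) : F.ModQ M →+ G.ModQ M :=
  AddCommGroup.DirectLimit.lift (F.HomTF M) (F.restr M) (G.ModQ M)
    (fun K => (G.germ M (G.idx K.ideal (h _ K.mem))).comp
      { toFun := fun φ => tfQuotMap M h ∘ₗ φ
        map_zero' := LinearMap.comp_zero _
        map_add' := fun φ ψ => LinearMap.comp_add _ _ _ })
    (fun K L hKL φ => by
      refine germ_eq _ _ _ _ ⊤ G.top_mem (fun b _ h1 h2 => ?_)
      rfl)

end

end GabrielFilter

/-! ### Bimodules and symmetric filters

An `R`-bimodule is an abelian group with commuting actions of `R` and `Rᵐᵒᵖ`; the right action is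
`x r = op r • x`. It is the same as a module over `R ⊗ Rᵐᵒᵖ`, with `(r ⊗ op s) • x = r x s`. -/

/-- The enveloping ring `R ⊗_ℤ Rᵐᵒᵖ`. -/
abbrev Env (R : Type u) [Ring R] : Type u := R ⊗[ℤ] Rᵐᵒᵖ

/-- A copy of the bimodule `M`, considered as a module over the enveloping ring. -/
def EnvMod (R : Type u) (M : Type v) [Ring R] : Type v := M

section

variable (R : Type u) [Ring R] (M : Type v) [AddCommGroup M]

instance : AddCommGroup (EnvMod R M) := inferInstanceAs (AddCommGroup M)

variable [Module R M] [Module Rᵐᵒᵖ M] [SMulCommClass R Rᵐᵒᵖ M]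

instance : Module (Env R) (EnvMod R M) := TensorProduct.Algebra.module (R := ℤ) (M := M)

/-- The identity map from `M` to its copy. -/
def toEnvMod : M →+ EnvMod R M := AddMonoidHom.id M

theorem tmul_smul_toEnvMod (r : R) (s : Rᵐᵒᵖ) (x : M) :
    (r ⊗ₜ[ℤ] s : Env R) • toEnvMod R M x = toEnvMod R M (r • s • x) :=
  TensorProduct.Algebra.smul_def r s x

end

section

variable {R : Type u} [Ring R]

/-- For a left ideal `I` and a right ideal `J` the left ideal `I ⊗ Rᵐᵒᵖ + R ⊗ J` of `R ⊗ Rᵐᵒᵖ`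
(more precisely, the sum of the images), generated by all `i ⊗ 1` and `1 ⊗ j`. -/
def symIdeal (I : Ideal R) (J : Ideal Rᵐᵒᵖ) : Ideal (Env R) :=
  Ideal.span ((fun i : R => (i ⊗ₜ[ℤ] 1 : Env R)) '' I) ⊔
    Ideal.span ((fun j : Rᵐᵒᵖ => (1 ⊗ₜ[ℤ] j : Env R)) '' J)

theorem symIdeal_le {I : Ideal R} {J : Ideal Rᵐᵒᵖ} {K : Ideal (Env R)} :
    symIdeal I J ≤ K ↔ (∀ i ∈ I, (i ⊗ₜ[ℤ] 1 : Env R) ∈ K) ∧ ∀ j ∈ J, (1 ⊗ₜ[ℤ] j : Env R) ∈ K := by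
  simp [symIdeal, Ideal.span_le, Set.subset_def]

theorem tmul_one_mem {I : Ideal R} {J : Ideal Rᵐᵒᵖ} {i : R} (hi : i ∈ I) :
    (i ⊗ₜ[ℤ] 1 : Env R) ∈ symIdeal I J := (symIdeal_le.1 le_rfl).1 i hi

theorem one_tmul_mem {I : Ideal R} {J : Ideal Rᵐᵒᵖ} {j : Rᵐᵒᵖ} (hj : j ∈ J) :
    (1 ⊗ₜ[ℤ] j : Env R) ∈ symIdeal I J := (symIdeal_le.1 le_rfl).2 j hj

theorem tmul_mem_left {I : Ideal R} {J : Ideal Rᵐᵒᵖ} {i : R} (hi : i ∈ I) (s : Rᵐᵒᵖ) :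
    (i ⊗ₜ[ℤ] s : Env R) ∈ symIdeal I J := by
  have := (symIdeal I J).mul_mem_left (1 ⊗ₜ[ℤ] s : Env R) (tmul_one_mem hi)
  simpa [Algebra.TensorProduct.tmul_mul_tmul] using this

theorem tmul_mem_right {I : Ideal R} {J : Ideal Rᵐᵒᵖ} {j : Rᵐᵒᵖ} (hj : j ∈ J) (r : R) :
    (r ⊗ₜ[ℤ] j : Env R) ∈ symIdeal I J := by
  have := (symIdeal I J).mul_mem_left (r ⊗ₜ[ℤ] 1 : Env R) (one_tmul_mem hj)
  simpa [Algebra.TensorProduct.tmul_mul_tmul] using this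

/-- The symmetric filter induced by a left and a right Gabriel filter of `R`. -/
def symFilter (Fl : GabrielFilter R) (Fr : GabrielFilter Rᵐᵒᵖ) : GabrielFilter (Env R) where
  ideals := {K | ∃ I ∈ Fl, ∃ J ∈ Fr, symIdeal I J ≤ K}
  top_mem := ⟨⊤, Fl.top_mem, ⊤, Fr.top_mem, le_top⟩
  mem_of_le := by
    rintro K L ⟨I, hI, J, hJ, h⟩ hKL
    exact ⟨I, hI, J, hJ, h.trans hKL⟩
  inf_mem := by
    rintro K L ⟨I, hI, J, hJ, h⟩ ⟨I', hI', J', hJ', h'⟩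
    rw [symIdeal_le] at h h'
    refine ⟨I ⊓ I', Fl.inf_mem hI hI', J ⊓ J', Fr.inf_mem hJ hJ', symIdeal_le.2 ⟨?_, ?_⟩⟩
    · exact fun i hi => ⟨h.1 i hi.1, h'.1 i hi.2⟩
    · exact fun j hj => ⟨h.2 j hj.1, h'.2 j hj.2⟩
  colon_mem := by
    rintro K ⟨I, hI, J, hJ, h⟩ a
    induction a using TensorProduct.induction_on with
    | zero =>
      exact ⟨I, hI, J, hJ, fun b _ => by simp⟩
    | tmul r s =>
      refine ⟨leftColon I r, Fl.colon_mem hI r, leftColon J s, Fr.colon_mem hJ s,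
        symIdeal_le.2 ⟨fun i hi => ?_, fun j hj => ?_⟩⟩
      · rw [mem_leftColon, Algebra.TensorProduct.tmul_mul_tmul]
        exact h (tmul_mem_left (mem_leftColon.1 hi) _)
      · rw [mem_leftColon, Algebra.TensorProduct.tmul_mul_tmul]
        exact h (tmul_mem_right (mem_leftColon.1 hj) _)
    | add a b ha hb =>
      obtain ⟨I, hI, J, hJ, h⟩ := ha
      obtain ⟨I', hI', J', hJ', h'⟩ := hb
      rw [symIdeal_le] at h h'
      refine ⟨I ⊓ I', Fl.inf_mem hI hI', J ⊓ J', Fr.inf_mem hJ hJ', symIdeal_le.2 ⟨?_, ?_⟩⟩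
      · intro i hi
        rw [mem_leftColon, mul_add]
        exact K.add_mem (mem_leftColon.1 (h.1 i hi.1)) (mem_leftColon.1 (h'.1 i hi.2))
      · intro j hj
        rw [mem_leftColon, mul_add]
        exact K.add_mem (mem_leftColon.1 (h.2 j hj.1)) (mem_leftColon.1 (h'.2 j hj.2))
  mem_of_colon := by
    rintro K L ⟨I, hI, J, hJ, h⟩ hK
    let I' : Ideal R :=
      { carrier := {i | (i ⊗ₜ[ℤ] 1 : Env R) ∈ K}
        zero_mem' := by simp
        add_mem' := fun {a b} ha hb => by
          simpa [TensorProduct.add_tmul] using K.add_mem ha hb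
        smul_mem' := fun c a ha => by
          simpa [Algebra.TensorProduct.tmul_mul_tmul] using K.mul_mem_left (c ⊗ₜ[ℤ] 1) ha }
    let J' : Ideal Rᵐᵒᵖ :=
      { carrier := {j | (1 ⊗ₜ[ℤ] j : Env R) ∈ K}
        zero_mem' := by simp
        add_mem' := fun {a b} ha hb => by
          simpa [TensorProduct.tmul_add] using K.add_mem ha hb
        smul_mem' := fun c a ha => by
          simpa [Algebra.TensorProduct.tmul_mul_tmul] using K.mul_mem_left (1 ⊗ₜ[ℤ] c) ha }
    have hI' : I' ∈ Fl := by
      refine Fl.mem_of_colon hI (fun i hi => ?_)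
      obtain ⟨I₁, hI₁, J₁, hJ₁, h₁⟩ := hK _ (h (tmul_one_mem hi))
      refine Fl.mem_of_le hI₁ (fun b hb => ?_)
      have := h₁ (tmul_one_mem hb)
      rw [mem_leftColon, Algebra.TensorProduct.tmul_mul_tmul, one_mul] at this
      exact mem_leftColon.2 this
    have hJ' : J' ∈ Fr := by
      refine Fr.mem_of_colon hJ (fun j hj => ?_)
      obtain ⟨I₁, hI₁, J₁, hJ₁, h₁⟩ := hK _ (h (one_tmul_mem hj))
      refine Fr.mem_of_le hJ₁ (fun b hb => ?_)
      have := h₁ (one_tmul_mem hb)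
      rw [mem_leftColon, Algebra.TensorProduct.tmul_mul_tmul, one_mul] at this
      exact mem_leftColon.2 this
    exact ⟨I', hI', J', hJ', symIdeal_le.2 ⟨fun i hi => hi, fun j hj => hj⟩⟩

end

/-! ### Symmetric modules and rings of quotients -/

section

variable {R : Type u} [Ring R] (Fl : GabrielFilter R) (Fr : GabrielFilter Rᵐᵒᵖ)
variable (M : Type v) [AddCommGroup M] [Module R M] [Module Rᵐᵒᵖ M] [SMulCommClass R Rᵐᵒᵖ M]

/-- The symmetric module of quotients of a bimodule: the direct limit of the groups of bimodule
homomorphisms `Hom(K, M / t(M))` over all `K` in the symmetric filter. -/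
def SymQ : Type (max u v) := (symFilter Fl Fr).ModQ (EnvMod R M)

instance : AddCommGroup (SymQ Fl Fr M) :=
  inferInstanceAs (AddCommGroup ((symFilter Fl Fr).ModQ (EnvMod R M)))

instance : Module (Env R) (SymQ Fl Fr M) :=
  inferInstanceAs (Module (Env R) ((symFilter Fl Fr).ModQ (EnvMod R M)))

instance : Module R (SymQ Fl Fr M) :=
  Module.compHom _ (Algebra.TensorProduct.includeLeftRingHom : R →+* Env R)

instance : Module Rᵐᵒᵖ (SymQ Fl Fr M) :=
  Module.compHom _ ((Algebra.TensorProduct.includeRight : Rᵐᵒᵖ →ₐ[ℤ] Env R) : Rᵐᵒᵖ →+* Env R)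

variable {Fl Fr M} in
theorem left_smul_def (r : R) (x : SymQ Fl Fr M) : r • x = (r ⊗ₜ[ℤ] 1 : Env R) • x := rfl

variable {Fl Fr M} in
theorem right_smul_def (s : Rᵐᵒᵖ) (x : SymQ Fl Fr M) : s • x = (1 ⊗ₜ[ℤ] s : Env R) • x := rfl

variable {Fl Fr M} in
theorem tmul_smul_symQ (r : R) (s : Rᵐᵒᵖ) (x : SymQ Fl Fr M) :
    (r ⊗ₜ[ℤ] s : Env R) • x = r • s • x := by
  rw [left_smul_def, right_smul_def, ← mul_smul, Algebra.TensorProduct.tmul_mul_tmul, one_mul,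
    mul_one]

instance : SMulCommClass R Rᵐᵒᵖ (SymQ Fl Fr M) where
  smul_comm r s x := by
    rw [← tmul_smul_symQ, left_smul_def, right_smul_def, ← mul_smul,
      Algebra.TensorProduct.tmul_mul_tmul, one_mul, mul_one]

instance : SMulCommClass Rᵐᵒᵖ R (SymQ Fl Fr M) := SMulCommClass.symm _ _ _

/-- The canonical map `q : M → M_F` into the symmetric module of quotients. -/
def toSymQ : M →+ SymQ Fl Fr M :=
  ((symFilter Fl Fr).toModQ (EnvMod R M)).toAddMonoidHom.comp (toEnvMod R M)

variable {Fl Fr M}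

theorem toSymQ_left_smul (r : R) (m : M) : toSymQ Fl Fr M (r • m) = r • toSymQ Fl Fr M m := by
  have := ((symFilter Fl Fr).toModQ (EnvMod R M)).map_smul (r ⊗ₜ[ℤ] 1) (toEnvMod R M m)
  rw [tmul_smul_toEnvMod, one_smul] at this
  exact this

theorem toSymQ_right_smul (s : Rᵐᵒᵖ) (m : M) : toSymQ Fl Fr M (s • m) = s • toSymQ Fl Fr M m := by
  have := ((symFilter Fl Fr).toModQ (EnvMod R M)).map_smul (1 ⊗ₜ[ℤ] s) (toEnvMod R M m)
  rw [tmul_smul_toEnvMod, one_smul] at this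
  exact this

theorem exists_left_smul_mem (x : SymQ Fl Fr M) :
    ∃ I ∈ Fl, ∀ i ∈ I, ∃ m, i • x = toSymQ Fl Fr M m := by
  obtain ⟨K, ⟨I, hI, J, hJ, h⟩, hK⟩ := GabrielFilter.exists_smul_mem x
  exact ⟨I, hI, fun i hi => hK _ (h (tmul_one_mem hi))⟩

theorem exists_right_smul_mem (x : SymQ Fl Fr M) :
    ∃ J ∈ Fr, ∀ j ∈ J, ∃ m, j • x = toSymQ Fl Fr M m := by
  obtain ⟨K, ⟨I, hI, J, hJ, h⟩, hK⟩ := GabrielFilter.exists_smul_mem x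
  exact ⟨J, hJ, fun j hj => hK _ (h (one_tmul_mem hj))⟩

theorem symQ_eq_zero {x : SymQ Fl Fr M} {I : Ideal R} {J : Ideal Rᵐᵒᵖ} (hI : I ∈ Fl) (hJ : J ∈ Fr)
    (h : ∀ i ∈ I, i • x = 0) (h' : ∀ j ∈ J, j • x = 0) : x = 0 := by
  have hle : symIdeal I J ≤ elemAnn (Env R) x :=
    symIdeal_le.2 ⟨fun i hi => mem_elemAnn.2 (h i hi), fun j hj => mem_elemAnn.2 (h' j hj)⟩
  exact GabrielFilter.modQ_eq_zero (F := symFilter Fl Fr) (M := EnvMod R M)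
    (K := symIdeal I J) ⟨I, hI, J, hJ, le_rfl⟩ (fun k hk => mem_elemAnn.1 (hle hk))

theorem symQ_ext {x y : SymQ Fl Fr M} {I : Ideal R} {J : Ideal Rᵐᵒᵖ} (hI : I ∈ Fl) (hJ : J ∈ Fr)
    (h : ∀ i ∈ I, i • x = i • y) (h' : ∀ j ∈ J, j • x = j • y) : x = y :=
  sub_eq_zero.1 (symQ_eq_zero hI hJ (fun i hi => by rw [smul_sub, h i hi, sub_self])
    (fun j hj => by rw [smul_sub, h' j hj, sub_self]))

/-- An auxiliary map on a tensor product, with values in germs along the filter of all ideals of a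
Gabriel filter: `r ⊗ s` is sent to the germ of `i ↦ f (i r) s`. -/
theorem exists_germ_map {A S : Type u} [Ring A] [AddCommGroup S] {N : Type w} [AddCommGroup N]
    (F : GabrielFilter A) {I : Ideal A} (hI : I ∈ F) (f : A → S →+ N)
    (hf : ∀ a ∈ I, ∀ b ∈ I, f (a + b) = f a + f b) :
    ∃ l : Filter A, (∀ K ∈ F, ∀ᶠ i in l, i ∈ K) ∧
      (∀ p : A → Prop, (∀ᶠ i in l, p i) → ∃ K ∈ F, ∀ i ∈ K, p i) ∧
      ∃ Ψ : A ⊗[ℤ] S →+ l.Germ N,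
        ∀ r s, Ψ (r ⊗ₜ s) = ((fun i => f (i * r) s : A → N) : l.Germ N) := by
  set l : Filter A := ⨅ K : F.Index, Filter.principal (K.ideal : Set A) with hl
  have hmem : ∀ K ∈ F, ∀ᶠ i in l, i ∈ K := fun K hK =>
    Filter.mem_iInf_of_mem (F.idx K hK) (Filter.mem_principal_self _)
  let B : A →+ S →+ l.Germ N :=
    AddMonoidHom.mk' (fun r => AddMonoidHom.mk'
      (fun s => ((fun i => f (i * r) s : A → N) : l.Germ N))
      (fun s t => by
        rw [← Filter.Germ.coe_add, Filter.Germ.coe_eq]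
        exact Filter.Eventually.of_forall (fun i => map_add _ _ _)))
      (fun r r' => by
        ext s
        change ((fun i => f (i * (r + r')) s : A → N) : l.Germ N) =
          ((fun i => f (i * r) s : A → N) : l.Germ N) + ((fun i => f (i * r') s : A → N) : l.Germ N)
        rw [← Filter.Germ.coe_add, Filter.Germ.coe_eq]
        filter_upwards [hmem _ (F.colon_mem hI r), hmem _ (F.colon_mem hI r')] with i h1 h2
        rw [mul_add, hf _ (mem_leftColon.1 h1) _ (mem_leftColon.1 h2)]
        rfl)
  refine ⟨l, hmem, fun p hp => ?_, TensorProduct.liftAddHom B (fun z a s => ?_), fun r s => rfl⟩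
  · have hdir : Directed (· ≥ ·) (fun K : F.Index => Filter.principal (K.ideal : Set A)) := by
      intro K L
      obtain ⟨P, h1, h2⟩ := exists_ge_ge K L
      exact ⟨P, Filter.principal_mono.2 h1, Filter.principal_mono.2 h2⟩
    obtain ⟨K, hK⟩ := (Filter.mem_iInf_of_directed hdir _).1 hp
    exact ⟨K.ideal, K.mem, fun i hi => hK hi⟩
  · rw [map_zsmul, map_zsmul]
    rfl

theorem symQ_exists_of_graph (Γ : Submodule (Env R) (Env R × SymQ Fl Fr M))
    (hΓ : ∀ n, (0, n) ∈ Γ → n = 0) (K : Ideal (Env R)) (hK : K ∈ symFilter Fl Fr)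
    (hKΓ : ∀ k ∈ K, ∃ n, (k, n) ∈ Γ) : ∃ x : SymQ Fl Fr M, ∀ a n, (a, n) ∈ Γ → a • x = n :=
  GabrielFilter.exists_of_graph (F := symFilter Fl Fr) (M := EnvMod R M) Γ hΓ K hK hKΓ

/-- An element of the symmetric module of quotients is given by a left and a right linear map that
are compatible. -/
theorem exists_of_pair {I : Ideal R} {J : Ideal Rᵐᵒᵖ} (hI : I ∈ Fl) (hJ : J ∈ Fr)
    (f : R → SymQ Fl Fr M) (g : Rᵐᵒᵖ → SymQ Fl Fr M)
    (hf : ∀ a ∈ I, ∀ b ∈ I, f (a + b) = f a + f b) (hf' : ∀ r, ∀ a ∈ I, f (r * a) = r • f a)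
    (hg : ∀ a ∈ J, ∀ b ∈ J, g (a + b) = g a + g b) (hg' : ∀ r, ∀ a ∈ J, g (r * a) = r • g a)
    (hfg : ∀ i ∈ I, ∀ j ∈ J, j • f i = i • g j) :
    ∃ x : SymQ Fl Fr M, (∀ i ∈ I, i • x = f i) ∧ ∀ j ∈ J, j • x = g j := by
  let T : Set (Env R × SymQ Fl Fr M) :=
    ((fun i : R => ((i ⊗ₜ[ℤ] 1 : Env R), f i)) '' I) ∪
      ((fun j : Rᵐᵒᵖ => ((1 ⊗ₜ[ℤ] j : Env R), g j)) '' J)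
  let Γ : Submodule (Env R) (Env R × SymQ Fl Fr M) := Submodule.span _ T
  have hΓ : ∀ n, ((0 : Env R), n) ∈ Γ → n = 0 := by
    obtain ⟨l, hl, hl', Ψ, hΨ⟩ := exists_germ_map (S := Rᵐᵒᵖ) (N := SymQ Fl Fr M) Fl hI
      (fun r => AddMonoidHom.mk' (fun s => s • f r) (fun s t => add_smul s t _))
      (fun a ha b hb => by ext s; simp [hf a ha b hb])
    obtain ⟨l₂, hl₂, hl₂', Ψ₂, hΨ₂⟩ := exists_germ_map (S := R) (N := SymQ Fl Fr M) Fr hJ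
      (fun s => AddMonoidHom.mk' (fun r => r • g s) (fun s t => add_smul s t _))
      (fun a ha b hb => by ext s; simp [hg a ha b hb])
    have h1 : ∀ x ∈ Γ, ((fun i => i • x.2 : R → SymQ Fl Fr M) : l.Germ _) = Ψ x.1 := by
      intro x hx
      induction hx using Submodule.closure_induction with
      | zero =>
        simp only [Prod.snd_zero, smul_zero]
        exact (map_zero _).symm
      | add x y _ _ h h' =>
        simp only [Prod.fst_add, Prod.snd_add, smul_add, map_add, ← h, ← h']; rfl
      | smul_mem e x hx =>
        induction e using TensorProduct.induction_on with
        | zero =>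
          have h0 : (0 : Env R) • x = 0 := zero_smul (Env R) x
          erw [h0]
          simp only [Prod.snd_zero, smul_zero]
          exact (map_zero Ψ).symm
        | add a b ha hb =>
          simp only [add_smul, Prod.fst_add, Prod.snd_add, smul_add, map_add, ← ha, ← hb]; rfl
        | tmul r s =>
          obtain ⟨i, hi, rfl⟩ | ⟨j, hj, rfl⟩ := hx
          · simp only [Prod.smul_mk, smul_eq_mul, Algebra.TensorProduct.tmul_mul_tmul, hΨ, mul_one]
            congr 1
            funext a
            rw [tmul_smul_symQ, ← mul_smul, smul_comm, ← hf' _ _ hi, ← mul_assoc]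
            rfl
          · simp only [Prod.smul_mk, smul_eq_mul, Algebra.TensorProduct.tmul_mul_tmul, hΨ, mul_one]
            rw [Filter.Germ.coe_eq]
            filter_upwards [hl _ (Fl.colon_mem hI r)] with a ha
            rw [tmul_smul_symQ, ← mul_smul, smul_comm, ← hfg _ (mem_leftColon.1 ha) _ hj,
              ← mul_smul]
            rfl
    have h2 : ∀ x ∈ Γ, ((fun i => i • x.2 : Rᵐᵒᵖ → SymQ Fl Fr M) : l₂.Germ _) =
        Ψ₂ (TensorProduct.comm ℤ R Rᵐᵒᵖ x.1) := by
      intro x hx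
      induction hx using Submodule.closure_induction with
      | zero =>
        simp only [Prod.snd_zero, smul_zero]
        exact ((congrArg Ψ₂ (map_zero _)).trans (map_zero _)).symm
      | add x y _ _ h h' =>
        simp only [Prod.fst_add, Prod.snd_add, smul_add, map_add, ← h, ← h']; rfl
      | smul_mem e x hx =>
        induction e using TensorProduct.induction_on with
        | zero =>
          have h0 : (0 : Env R) • x = 0 := zero_smul (Env R) x
          erw [h0]
          simp only [Prod.snd_zero, smul_zero]
          exact ((congrArg Ψ₂ (map_zero _)).trans (map_zero Ψ₂)).symm
        | add a b ha hb =>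
          simp only [add_smul, Prod.fst_add, Prod.snd_add, smul_add, map_add, ← ha, ← hb]; rfl
        | tmul r s =>
          obtain ⟨i, hi, rfl⟩ | ⟨j, hj, rfl⟩ := hx
          · simp only [Prod.smul_mk, smul_eq_mul, Algebra.TensorProduct.tmul_mul_tmul, mul_one,
              TensorProduct.comm_tmul, hΨ₂]
            rw [Filter.Germ.coe_eq]
            filter_upwards [hl₂ _ (Fr.colon_mem hJ s)] with a ha
            rw [tmul_smul_symQ, smul_comm r s, ← mul_smul, smul_comm, hfg _ hi _ (mem_leftColon.1 ha),
              ← mul_smul]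
            rfl
          · simp only [Prod.smul_mk, smul_eq_mul, Algebra.TensorProduct.tmul_mul_tmul, mul_one,
              TensorProduct.comm_tmul, hΨ₂]
            congr 1
            funext a
            rw [tmul_smul_symQ, smul_comm r s, ← mul_smul, smul_comm, ← hg' _ _ hj, ← mul_assoc]
            rfl
    intro n hn
    have e1 := h1 _ hn
    have e2 := h2 _ hn
    simp only [map_zero] at e1 e2
    obtain ⟨K, hK, hK'⟩ := hl' _ (Filter.Germ.coe_eq.1 e1)
    obtain ⟨L, hL, hL'⟩ := hl₂' _ (Filter.Germ.coe_eq.1 e2)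
    exact symQ_eq_zero hK hL hK' hL'
  have hdom : ∀ k ∈ symIdeal I J, ∃ n, (k, n) ∈ Γ := by
    intro k hk
    have hle : symIdeal I J ≤ Γ.map (LinearMap.fst (Env R) (Env R) (SymQ Fl Fr M)) := by
      refine symIdeal_le.2 ⟨fun i hi => ?_, fun j hj => ?_⟩
      · exact ⟨(i ⊗ₜ 1, f i), Submodule.subset_span (Or.inl ⟨i, hi, rfl⟩), rfl⟩
      · exact ⟨(1 ⊗ₜ j, g j), Submodule.subset_span (Or.inr ⟨j, hj, rfl⟩), rfl⟩
    obtain ⟨⟨a, n⟩, h, rfl⟩ := hle hk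
    exact ⟨n, h⟩
  obtain ⟨x, hx⟩ := symQ_exists_of_graph Γ hΓ
    (symIdeal I J) ⟨I, hI, J, hJ, le_rfl⟩ hdom
  exact ⟨x, fun i hi => hx _ _ (Submodule.subset_span (Or.inl ⟨i, hi, rfl⟩)),
    fun j hj => hx _ _ (Submodule.subset_span (Or.inr ⟨j, hj, rfl⟩))⟩

end

/-! ### The ring structure on the symmetric ring of quotients -/

section

variable {R : Type u} [Ring R] (Fl : GabrielFilter R) (Fr : GabrielFilter Rᵐᵒᵖ)

/-- The symmetric ring of quotients of `R`. -/
abbrev SymRing : Type u := SymQ Fl Fr R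

variable {Fl Fr}

/-- `z` is the product of `x` and `y`: if `i x = q(r)` then `i z = r y`, and if `y j = q(s)` then
`z j = x s`. -/
def IsSymProd (x y z : SymRing Fl Fr) : Prop :=
  (∀ i r : R, i • x = toSymQ Fl Fr R r → i • z = r • y) ∧
    ∀ (j : Rᵐᵒᵖ) (s : R), j • y = toSymQ Fl Fr R s → j • z = op s • x

theorem toSymQ_op (r s : R) : op s • toSymQ Fl Fr R r = r • toSymQ Fl Fr R s := by
  rw [← toSymQ_right_smul, ← toSymQ_left_smul]
  rfl

theorem ext_of_toSymQ {r r' : R} (h : toSymQ Fl Fr R r = toSymQ Fl Fr R r') :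
    (∃ K ∈ Fl, ∀ k ∈ K, k * r = k * r') ∧ ∃ K ∈ Fr, ∀ k ∈ K, r * unop k = r' * unop k := by
  have h0 : toSymQ Fl Fr R (r - r') = 0 := by rw [map_sub, h, sub_self]
  obtain ⟨I, hI, J, hJ, hle⟩ := (GabrielFilter.toModQ_eq_zero_iff _).1 h0
  rw [symIdeal_le] at hle
  refine ⟨⟨I, hI, fun k hk => ?_⟩, ⟨J, hJ, fun k hk => ?_⟩⟩
  · have := mem_elemAnn.1 (hle.1 k hk)
    rw [tmul_smul_toEnvMod, one_smul] at this
    have h2 : k * (r - r') = 0 := this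
    rwa [mul_sub, sub_eq_zero] at h2
  · have := mem_elemAnn.1 (hle.2 k hk)
    rw [tmul_smul_toEnvMod, one_smul] at this
    have h2 : (r - r') * unop k = 0 := this
    rwa [sub_mul, sub_eq_zero] at h2

theorem left_smul_congr {r r' : R} (h : toSymQ Fl Fr R r = toSymQ Fl Fr R r')
    (y : SymRing Fl Fr) : r • y = r' • y := by
  obtain ⟨⟨K, hK, hKr⟩, -⟩ := ext_of_toSymQ h
  obtain ⟨J, hJ, hy⟩ := exists_right_smul_mem y
  refine symQ_ext hK hJ (fun i hi => ?_) (fun j hj => ?_)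
  · rw [← mul_smul, ← mul_smul, hKr i hi]
  · obtain ⟨m, hm⟩ := hy j hj
    rw [smul_comm j, smul_comm j, hm, ← toSymQ_op, ← toSymQ_op, h]

theorem right_smul_congr {r r' : R} (h : toSymQ Fl Fr R r = toSymQ Fl Fr R r')
    (y : SymRing Fl Fr) : op r • y = op r' • y := by
  obtain ⟨-, ⟨K, hK, hKr⟩⟩ := ext_of_toSymQ h
  obtain ⟨J, hJ, hy⟩ := exists_left_smul_mem y
  refine symQ_ext hJ hK (fun i hi => ?_) (fun j hj => ?_)
  · obtain ⟨m, hm⟩ := hy i hi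
    rw [smul_comm, smul_comm i, hm, toSymQ_op, toSymQ_op, h]
  · rw [← mul_smul, ← mul_smul, ← op_unop j, ← op_mul, ← op_mul, hKr j hj]

theorem IsSymProd.unique {x y z z' : SymRing Fl Fr} (h : IsSymProd x y z) (h' : IsSymProd x y z') :
    z = z' := by
  obtain ⟨I, hI, hx⟩ := exists_left_smul_mem x
  obtain ⟨J, hJ, hy⟩ := exists_right_smul_mem y
  refine symQ_ext hI hJ (fun i hi => ?_) (fun j hj => ?_)
  · obtain ⟨m, hm⟩ := hx i hi
    rw [h.1 i m hm, h'.1 i m hm]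
  · obtain ⟨m, hm⟩ := hy j hj
    rw [h.2 j m hm, h'.2 j m hm]

theorem isSymProd_of_ideals {x y z : SymRing Fl Fr} {I : Ideal R} {J : Ideal Rᵐᵒᵖ}
    (hI : I ∈ Fl) (hJ : J ∈ Fr)
    (h : ∀ i ∈ I, ∃ r, i • x = toSymQ Fl Fr R r ∧ i • z = r • y)
    (h' : ∀ j ∈ J, ∃ s, j • y = toSymQ Fl Fr R s ∧ j • z = op s • x) : IsSymProd x y z := by
  refine ⟨fun i r hr => ?_, fun j s hs => ?_⟩
  · refine symQ_ext (Fl.colon_mem hI i) hJ (fun a ha => ?_) (fun j hj => ?_)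
    · obtain ⟨m, hm, hm'⟩ := h _ (mem_leftColon.1 ha)
      rw [← mul_smul, hm', ← mul_smul]
      refine left_smul_congr ?_ y
      rw [← hm, mul_smul, hr, ← toSymQ_left_smul]
      rfl
    · obtain ⟨s, hs, hs'⟩ := h' j hj
      rw [← smul_comm, hs', smul_comm, hr, ← smul_comm r, hs, toSymQ_op]
  · refine symQ_ext hI (Fr.colon_mem hJ j) (fun i hi => ?_) (fun a ha => ?_)
    · obtain ⟨r, hr, hr'⟩ := h i hi
      rw [smul_comm, hr', ← smul_comm r, hs, smul_comm i, hr, toSymQ_op]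
    · obtain ⟨m, hm, hm'⟩ := h' _ (mem_leftColon.1 ha)
      rw [← mul_smul, hm', ← mul_smul]
      have : a * op s = op (s * unop a) := by rw [op_mul, op_unop]
      rw [this]
      refine right_smul_congr ?_ x
      rw [← hm, mul_smul, hs, ← toSymQ_right_smul]
      rfl

theorem exists_isSymProd (x y : SymRing Fl Fr) : ∃ z, IsSymProd x y z := by
  classical
  obtain ⟨I, hI, hx⟩ := exists_left_smul_mem x
  obtain ⟨J, hJ, hy⟩ := exists_right_smul_mem y
  let f : R → SymRing Fl Fr := fun i =>
    if h : ∃ r, i • x = toSymQ Fl Fr R r then h.choose • y else 0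
  let g : Rᵐᵒᵖ → SymRing Fl Fr := fun j =>
    if h : ∃ s, j • y = toSymQ Fl Fr R s then op h.choose • x else 0
  have hf : ∀ i r, i • x = toSymQ Fl Fr R r → f i = r • y := by
    intro i r h
    have h' : ∃ r, i • x = toSymQ Fl Fr R r := ⟨r, h⟩
    simp only [f, dif_pos h']
    exact left_smul_congr (h'.choose_spec.symm.trans h) y
  have hg : ∀ j s, j • y = toSymQ Fl Fr R s → g j = op s • x := by
    intro j s h
    have h' : ∃ s, j • y = toSymQ Fl Fr R s := ⟨s, h⟩
    simp only [g, dif_pos h']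
    exact right_smul_congr (h'.choose_spec.symm.trans h) x
  obtain ⟨z, hz, hz'⟩ := exists_of_pair hI hJ f g
    (by
      intro a ha b hb
      obtain ⟨r, hr⟩ := hx a ha
      obtain ⟨s, hs⟩ := hx b hb
      rw [hf _ _ hr, hf _ _ hs, hf (a + b) (r + s) (by rw [add_smul, hr, hs, map_add]), add_smul])
    (by
      intro c a ha
      obtain ⟨r, hr⟩ := hx a ha
      rw [hf _ _ hr, hf (c * a) (c * r) (by rw [mul_smul, hr, ← toSymQ_left_smul]; rfl), mul_smul])
    (by
      intro a ha b hb
      obtain ⟨r, hr⟩ := hy a ha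
      obtain ⟨s, hs⟩ := hy b hb
      rw [hg _ _ hr, hg _ _ hs, hg (a + b) (r + s) (by rw [add_smul, hr, hs, map_add]), op_add,
        add_smul])
    (by
      intro c a ha
      obtain ⟨r, hr⟩ := hy a ha
      rw [hg _ _ hr, hg (c * a) (r * unop c) (by rw [mul_smul, hr, ← toSymQ_right_smul]; rfl),
        op_mul, op_unop, mul_smul])
    (by
      intro i hi j hj
      obtain ⟨r, hr⟩ := hx i hi
      obtain ⟨s, hs⟩ := hy j hj
      rw [hf _ _ hr, hg _ _ hs, ← smul_comm, hs, smul_comm, hr, toSymQ_op])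
  refine ⟨z, isSymProd_of_ideals hI hJ (fun i hi => ?_) (fun j hj => ?_)⟩
  · obtain ⟨r, hr⟩ := hx i hi
    exact ⟨r, hr, by rw [hz i hi, hf i r hr]⟩
  · obtain ⟨r, hr⟩ := hy j hj
    exact ⟨r, hr, by rw [hz' j hj, hg j r hr]⟩

instance : One (SymRing Fl Fr) := ⟨toSymQ Fl Fr R 1⟩

instance : Mul (SymRing Fl Fr) := ⟨fun x y => (exists_isSymProd x y).choose⟩

theorem isSymProd_mul (x y : SymRing Fl Fr) : IsSymProd x y (x * y) :=
  (exists_isSymProd x y).choose_spec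

theorem symOne_def : (1 : SymRing Fl Fr) = toSymQ Fl Fr R 1 := rfl

theorem left_smul_symOne (r : R) : r • (1 : SymRing Fl Fr) = toSymQ Fl Fr R r := by
  rw [symOne_def, ← toSymQ_left_smul, smul_eq_mul, mul_one]

theorem right_smul_symOne (r : R) : op r • (1 : SymRing Fl Fr) = toSymQ Fl Fr R r := by
  rw [symOne_def, ← toSymQ_right_smul, op_smul_eq_mul, one_mul]

theorem toSymQ_mul' (r : R) (y : SymRing Fl Fr) : toSymQ Fl Fr R r * y = r • y := by
  rw [← one_smul R (toSymQ Fl Fr R r * y)]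
  exact (isSymProd_mul _ y).1 1 r (one_smul _ _)

theorem mul_toSymQ' (x : SymRing Fl Fr) (s : R) : x * toSymQ Fl Fr R s = op s • x := by
  rw [← one_smul Rᵐᵒᵖ (x * toSymQ Fl Fr R s)]
  exact (isSymProd_mul x _).2 1 s (one_smul _ _)

theorem left_smul_mul' (r : R) (x y : SymRing Fl Fr) : (r • x) * y = r • (x * y) := by
  obtain ⟨I, hI, hx⟩ := exists_left_smul_mem x
  obtain ⟨J, hJ, hy⟩ := exists_right_smul_mem y
  refine IsSymProd.unique (isSymProd_mul _ _)
    (isSymProd_of_ideals (Fl.colon_mem hI r) hJ (fun i hi => ?_) (fun j hj => ?_))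
  · obtain ⟨m, hm⟩ := hx _ (mem_leftColon.1 hi)
    exact ⟨m, by rw [← mul_smul, hm], by rw [← mul_smul, (isSymProd_mul x y).1 _ m hm]⟩
  · obtain ⟨m, hm⟩ := hy j hj
    exact ⟨m, hm, by rw [← smul_comm, (isSymProd_mul x y).2 j m hm, smul_comm]⟩

theorem mul_right_smul' (s : Rᵐᵒᵖ) (x y : SymRing Fl Fr) : x * (s • y) = s • (x * y) := by
  obtain ⟨I, hI, hx⟩ := exists_left_smul_mem x
  obtain ⟨J, hJ, hy⟩ := exists_right_smul_mem y
  refine IsSymProd.unique (isSymProd_mul _ _)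
    (isSymProd_of_ideals hI (Fr.colon_mem hJ s) (fun i hi => ?_) (fun j hj => ?_))
  · obtain ⟨m, hm⟩ := hx i hi
    exact ⟨m, hm, by rw [smul_comm, (isSymProd_mul x y).1 i m hm, smul_comm]⟩
  · obtain ⟨m, hm⟩ := hy _ (mem_leftColon.1 hj)
    exact ⟨m, by rw [← mul_smul, hm],
      by rw [← mul_smul, ← (isSymProd_mul x y).2 (j * s) m hm]⟩

theorem add_symMul (x x' y : SymRing Fl Fr) : (x + x') * y = x * y + x' * y := by
  obtain ⟨I, hI, hx⟩ := exists_left_smul_mem x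
  obtain ⟨I', hI', hx'⟩ := exists_left_smul_mem x'
  obtain ⟨J, hJ, hy⟩ := exists_right_smul_mem y
  refine IsSymProd.unique (isSymProd_mul _ _)
    (isSymProd_of_ideals (Fl.inf_mem hI hI') hJ (fun i hi => ?_) (fun j hj => ?_))
  · obtain ⟨m, hm⟩ := hx i hi.1
    obtain ⟨m', hm'⟩ := hx' i hi.2
    exact ⟨m + m', by rw [smul_add, hm, hm', map_add], by
      rw [smul_add, (isSymProd_mul x y).1 i m hm, (isSymProd_mul x' y).1 i m' hm', add_smul]⟩
  · obtain ⟨m, hm⟩ := hy j hj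
    exact ⟨m, hm, by
      have h1 := (isSymProd_mul x y).2 j m hm
      have h2 := (isSymProd_mul x' y).2 j m hm
      rw [smul_add, h1, h2, smul_add]⟩

theorem symMul_add (x y y' : SymRing Fl Fr) : x * (y + y') = x * y + x * y' := by
  obtain ⟨I, hI, hx⟩ := exists_left_smul_mem x
  obtain ⟨J, hJ, hy⟩ := exists_right_smul_mem y
  obtain ⟨J', hJ', hy'⟩ := exists_right_smul_mem y'
  refine IsSymProd.unique (isSymProd_mul _ _)
    (isSymProd_of_ideals hI (Fr.inf_mem hJ hJ') (fun i hi => ?_) (fun j hj => ?_))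
  · obtain ⟨m, hm⟩ := hx i hi
    exact ⟨m, hm, by
      rw [smul_add, (isSymProd_mul x y).1 i m hm, (isSymProd_mul x y').1 i m hm, smul_add]⟩
  · obtain ⟨m, hm⟩ := hy j hj.1
    obtain ⟨m', hm'⟩ := hy' j hj.2
    exact ⟨m + m', by rw [smul_add, hm, hm', map_add], by
      have h1 := (isSymProd_mul x y).2 j m hm
      have h2 := (isSymProd_mul x y').2 j m' hm'
      rw [smul_add, h1, h2, op_add, add_smul]⟩

theorem symMul_assoc (x y z : SymRing Fl Fr) : x * y * z = x * (y * z) := by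
  obtain ⟨I, hI, hx⟩ := exists_left_smul_mem x
  obtain ⟨J, hJ, hz⟩ := exists_right_smul_mem z
  refine symQ_ext hI hJ (fun i hi => ?_) (fun j hj => ?_)
  · obtain ⟨r, hr⟩ := hx i hi
    rw [← left_smul_mul', ← left_smul_mul', ← left_smul_mul', hr, toSymQ_mul', toSymQ_mul',
      left_smul_mul']
  · obtain ⟨s, hs⟩ := hz j hj
    rw [← mul_right_smul', ← mul_right_smul', ← mul_right_smul', hs, mul_toSymQ', mul_toSymQ',
      mul_right_smul']

/-- The ring structure of the symmetric ring of quotients. -/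
instance : Ring (SymRing Fl Fr) :=
  { (inferInstance : AddCommGroup (SymRing Fl Fr)) with
    mul := (· * ·)
    one := 1
    left_distrib := symMul_add
    right_distrib := add_symMul
    mul_assoc := symMul_assoc
    one_mul := fun x => by rw [symOne_def, toSymQ_mul', one_smul]
    mul_one := fun x => by rw [symOne_def, mul_toSymQ', op_one, one_smul]
    zero_mul := fun x => by
      have h := toSymQ_mul' 0 x
      rwa [map_zero, zero_smul] at h
    mul_zero := fun x => by
      have h := mul_toSymQ' x 0
      rwa [map_zero, op_zero, zero_smul] at h }

variable (Fl Fr) in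
/-- The canonical ring homomorphism from `R` to the symmetric ring of quotients. -/
def toSymRing : R →+* SymRing Fl Fr where
  __ := toSymQ Fl Fr R
  map_one' := rfl
  map_mul' r s := by
    change toSymQ Fl Fr R (r * s) = toSymQ Fl Fr R r * toSymQ Fl Fr R s
    rw [toSymQ_mul', ← toSymQ_left_smul, smul_eq_mul]

end

/-! ### The Lambek, classical and Goldie filters -/

section

variable (A : Type u) [Ring A]

/-- The Gabriel filter of all dense left ideals: the filter of the Lambek torsion theory. -/
def lambekFilter : GabrielFilter A where
  ideals := {D | ∀ x y : A, y ≠ 0 → ∃ r : A, r * x ∈ D ∧ r * y ≠ 0}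
  top_mem := fun x y hy => ⟨1, trivial, by simpa using hy⟩
  mem_of_le := fun h hle x y hy => by
    obtain ⟨r, hr, hr'⟩ := h x y hy
    exact ⟨r, hle hr, hr'⟩
  inf_mem := fun {I J} hI hJ x y hy => by
    obtain ⟨r, hr, hr'⟩ := hI x y hy
    obtain ⟨s, hs, hs'⟩ := hJ (r * x) (r * y) hr'
    refine ⟨s * r, ⟨?_, ?_⟩, by rwa [mul_assoc]⟩
    · rw [mul_assoc]; exact I.mul_mem_left s hr
    · rw [mul_assoc]; exact hs
  colon_mem := fun {I} hI a x y hy => by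
    obtain ⟨r, hr, hr'⟩ := hI (x * a) y hy
    exact ⟨r, by rwa [mem_leftColon, mul_assoc], hr'⟩
  mem_of_colon := fun {I J} hJ h x y hy => by
    obtain ⟨r, hr, hr'⟩ := hJ x y hy
    obtain ⟨s, hs, hs'⟩ := h (r * x) hr 1 (r * y) hr'
    refine ⟨s * r, ?_, by rwa [mul_assoc]⟩
    rw [mul_one, mem_leftColon] at hs
    rwa [mul_assoc]

/-- The Gabriel filter of the classical torsion theory: `A / I` is torsion, i.e. every element of
`A / I` is annihilated by a regular element. -/
def classicalFilter : GabrielFilter A where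
  ideals := {I | ∀ a : A, ∃ t ∈ A⁰, t * a ∈ I}
  top_mem := fun _ => ⟨1, one_mem _, trivial⟩
  mem_of_le := fun h hle a => by
    obtain ⟨t, ht, h'⟩ := h a
    exact ⟨t, ht, hle h'⟩
  inf_mem := fun {I J} hI hJ a => by
    obtain ⟨t, ht, h⟩ := hI a
    obtain ⟨s, hs, h'⟩ := hJ (t * a)
    refine ⟨s * t, mul_mem hs ht, ⟨?_, ?_⟩⟩
    · rw [mul_assoc]; exact I.mul_mem_left s h
    · rw [mul_assoc]; exact h'
  colon_mem := fun {I} hI b a => by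
    obtain ⟨t, ht, h⟩ := hI (a * b)
    exact ⟨t, ht, by rwa [mem_leftColon, mul_assoc]⟩
  mem_of_colon := fun {I J} hJ h a => by
    obtain ⟨t, ht, h1⟩ := hJ a
    obtain ⟨s, hs, h2⟩ := h _ h1 1
    exact ⟨s * t, mul_mem hs ht, by
      rw [mul_one, mem_leftColon] at h2
      rwa [mul_assoc]⟩

variable {A}

/-- Essential left ideals: those that meet every nonzero left ideal. -/
def IsEssentialIdeal (I : Ideal A) : Prop := ∀ a : A, a ≠ 0 → ∃ r : A, r * a ∈ I ∧ r * a ≠ 0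

theorem IsEssentialIdeal.mono {I J : Ideal A} (h : IsEssentialIdeal I) (hle : I ≤ J) :
    IsEssentialIdeal J := fun a ha => by
  obtain ⟨r, hr, hr'⟩ := h a ha
  exact ⟨r, hle hr, hr'⟩

theorem IsEssentialIdeal.inf {I J : Ideal A} (h : IsEssentialIdeal I) (h' : IsEssentialIdeal J) :
    IsEssentialIdeal (I ⊓ J) := fun a ha => by
  obtain ⟨r, hr, hr'⟩ := h a ha
  obtain ⟨s, hs, hs'⟩ := h' _ hr'
  rw [← mul_assoc] at hs hs'
  exact ⟨s * r, ⟨by rw [mul_assoc]; exact I.mul_mem_left s hr, hs⟩, hs'⟩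

theorem IsEssentialIdeal.colon {I : Ideal A} (h : IsEssentialIdeal I) (b : A) :
    IsEssentialIdeal (leftColon I b) := fun a ha => by
  by_cases hab : a * b = 0
  · exact ⟨1, by simp [hab], by simpa using ha⟩
  · obtain ⟨r, hr, hr'⟩ := h _ hab
    refine ⟨r, by rwa [mem_leftColon, mul_assoc], fun h0 => hr' ?_⟩
    rw [← mul_assoc, h0, zero_mul]

variable (A) in
/-- The Gabriel filter of the Goldie torsion theory. -/
def goldieFilter : GabrielFilter A where
  ideals := {I | ∃ J : Ideal A, IsEssentialIdeal J ∧ ∀ j ∈ J, IsEssentialIdeal (leftColon I j)}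
  top_mem := ⟨⊤, fun a ha => ⟨1, trivial, by simpa using ha⟩,
    fun j _ a ha => ⟨1, by simp, by simpa using ha⟩⟩
  mem_of_le := by
    rintro I I' ⟨J, hJ, h⟩ hle
    exact ⟨J, hJ, fun j hj => (h j hj).mono (fun a ha => hle ha)⟩
  inf_mem := by
    rintro I I' ⟨J, hJ, h⟩ ⟨J', hJ', h'⟩
    exact ⟨J ⊓ J', hJ.inf hJ', fun j hj => ((h j hj.1).inf (h' j hj.2)).mono (fun a ha => ha)⟩
  colon_mem := by
    rintro I ⟨J, hJ, h⟩ a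
    refine ⟨leftColon J a, hJ.colon a, fun j hj => (h _ (mem_leftColon.1 hj)).mono (fun b hb => ?_)⟩
    simpa [mul_assoc] using hb
  mem_of_colon := by
    rintro I K ⟨J, hJ, h⟩ hK
    let E : Ideal A :=
      { carrier := {r | IsEssentialIdeal (leftColon I r)}
        zero_mem' := fun a ha => ⟨1, by simp, by simpa using ha⟩
        add_mem' := fun {a b} ha hb => (IsEssentialIdeal.inf ha hb).mono (fun c hc => by
          have h1 := mem_leftColon.1 hc.1
          have h2 := mem_leftColon.1 hc.2
          rw [mem_leftColon, mul_add]
          exact I.add_mem h1 h2)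
        smul_mem' := fun c a ha => (IsEssentialIdeal.colon ha c).mono (fun b hb => by
          simpa [mul_assoc] using hb) }
    refine ⟨E, fun a ha => ?_, fun j hj => hj⟩
    have hker : ∀ c : A, IsEssentialIdeal (elemAnn A c) → c ∈ E := fun c hc =>
      IsEssentialIdeal.mono hc (fun b hb => by
        have h0 : b * c = 0 := mem_elemAnn.1 hb
        simp [h0])
    obtain ⟨r, hr, hr'⟩ := hJ a ha
    by_cases h1 : ∀ s ∈ leftColon K (r * a), s * (r * a) = 0
    · exact ⟨r, hker _ ((h _ hr).mono (fun s hs => mem_elemAnn.2 (h1 s hs))), hr'⟩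
    · push Not at h1
      obtain ⟨s, hs, hs'⟩ := h1
      obtain ⟨L, hL, hL'⟩ := hK _ (mem_leftColon.1 hs)
      by_cases h2 : ∀ b ∈ L, b * (s * (r * a)) = 0
      · exact ⟨s * r, by
          rw [mul_assoc]
          exact hker _ (hL.mono (fun b hb => mem_elemAnn.2 (h2 b hb))), by rwa [mul_assoc]⟩
      · push Not at h2
        obtain ⟨b, hb, hb'⟩ := h2
        refine ⟨b * s * r, ?_, by rwa [mul_assoc, mul_assoc]⟩
        rw [mul_assoc, mul_assoc]
        refine (hL' b hb).mono (fun c hc => ?_)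
        simpa [mul_assoc] using hc

/-- A module is torsion-free for the Goldie torsion theory if and only if it is nonsingular, i.e.
`0` is its only element with essential annihilator. -/
theorem goldie_torsion_eq_bot_iff (M : Type v) [AddCommGroup M] [Module A M] :
    (goldieFilter A).torsion M = ⊥ ↔ ∀ x : M, IsEssentialIdeal (elemAnn A x) → x = 0 := by
  rw [Submodule.eq_bot_iff]
  constructor
  · intro h x hx
    exact h x ⟨elemAnn A x, hx, fun j _ => hx.colon j⟩
  · rintro h x ⟨J, hJ, hx⟩
    refine h x (hJ.mono (fun j hj => ?_))
    rw [mem_elemAnn]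
    refine h _ ((hx j hj).mono (fun b hb => ?_))
    simpa [mul_smul] using hb

end

/-! ### Perfect symmetric rings of quotients and the total one -/

section

variable {R : Type u} [Ring R]

/-- `f : R → S` makes `S` into a perfect symmetric ring of quotients, with corresponding filters
`{I | S f(I) = S}` and `{J | f(J) S = S}`. -/
structure IsPerfectSymRing {S : Type v} [Ring S] (f : R →+* S)
    (Fl : GabrielFilter R) (Fr : GabrielFilter Rᵐᵒᵖ) : Prop where
  left : ∀ I : Ideal R, I ∈ Fl ↔ Ideal.map f I = ⊤
  right : ∀ J : Ideal Rᵐᵒᵖ, J ∈ Fr ↔ Ideal.map (RingHom.op f) J = ⊤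
  iso : ∃ g : S ≃+* SymRing Fl Fr, ∀ r, g (f r) = toSymRing Fl Fr r

/-- The symmetric filter induced by `Fl` and `Fr` is perfect. -/
def IsPerfectPair (Fl : GabrielFilter R) (Fr : GabrielFilter Rᵐᵒᵖ) : Prop :=
  ∃ (S : Type u) (_ : Ring S) (f : R →+* S), IsPerfectSymRing f Fl Fr

/-- The pair of filters of the total symmetric ring of quotients, the largest perfect symmetric
ring of quotients that contains `R`. -/
structure IsTotalPair (Fl : GabrielFilter R) (Fr : GabrielFilter Rᵐᵒᵖ) : Prop where
  perfect : IsPerfectPair Fl Fr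
  left_faithful : Fl.IsFaithful
  right_faithful : Fr.IsFaithful
  largest : ∀ (Gl : GabrielFilter R) (Gr : GabrielFilter Rᵐᵒᵖ), IsPerfectPair Gl Gr →
    Gl.IsFaithful → Gr.IsFaithful → Gl ≤ Fl ∧ Gr ≤ Fr

end

/-! ### Derivations and the agreement of their extensions -/

section

variable {R : Type u} [Ring R]

/-- Derivations of a ring. -/
def IsRingDerivation (δ : R →+ R) : Prop := ∀ r s : R, δ (r * s) = δ r * s + r * δ s

/-- `δ`-derivations of a bimodule: `d(r x) = δ(r) x + r d(x)` and `d(x r) = d(x) r + x δ(r)`. -/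
structure IsBimoduleDerivation (δ : R →+ R) {M : Type v} [AddCommGroup M] [Module R M]
    [Module Rᵐᵒᵖ M] (d : M →+ M) : Prop where
  left : ∀ (r : R) (x : M), d (r • x) = δ r • x + r • d x
  right : ∀ (r : R) (x : M), d (op r • x) = op r • d x + op (δ r) • x

/-- The map `r ⊗ s ↦ δ(r) ⊗ s + r ⊗ δ(s)` on the enveloping ring. -/
def envDerivation (δ : R →+ R) : Env R →+ Env R :=
  (TensorProduct.map δ.toIntLinearMap LinearMap.id +
    TensorProduct.map LinearMap.id (AddMonoidHom.mulOp δ).toIntLinearMap :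
      R ⊗[ℤ] Rᵐᵒᵖ →ₗ[ℤ] R ⊗[ℤ] Rᵐᵒᵖ).toAddMonoidHom

/-- The symmetric filter is differential. -/
def IsDifferential (F : GabrielFilter (Env R)) : Prop :=
  ∀ δ : R →+ R, IsRingDerivation δ →
    ∀ I ∈ F, ∃ J ∈ F, ∀ a ∈ J, envDerivation δ a ∈ I

/-- `D` is an extension of the `δ`-derivation `d` to the symmetric module of quotients. -/
structure IsModuleExtension (Fl : GabrielFilter R) (Fr : GabrielFilter Rᵐᵒᵖ) (δ : R →+ R)
    {M : Type v} [AddCommGroup M] [Module R M] [Module Rᵐᵒᵖ M] [SMulCommClass R Rᵐᵒᵖ M]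
    (d : M →+ M) (D : SymQ Fl Fr M →+ SymQ Fl Fr M) : Prop where
  deriv : IsBimoduleDerivation δ D
  comm : ∀ x : M, D (toSymQ Fl Fr M x) = toSymQ Fl Fr M (d x)

/-- `D` is an extension of the derivation `δ` to a derivation of the symmetric ring of
quotients. -/
structure IsRingExtension (Fl : GabrielFilter R) (Fr : GabrielFilter Rᵐᵒᵖ) (δ : R →+ R)
    (D : SymRing Fl Fr →+ SymRing Fl Fr) : Prop where
  deriv : IsRingDerivation D
  comm : ∀ r : R, D (toSymRing Fl Fr r) = toSymRing Fl Fr (δ r)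

section

variable {Fl Gl : GabrielFilter R} {Fr Gr : GabrielFilter Rᵐᵒᵖ} (M : Type v) [AddCommGroup M]
  [Module R M] [Module Rᵐᵒᵖ M] [SMulCommClass R Rᵐᵒᵖ M]

/-- The canonical map between symmetric modules of quotients for an inclusion of symmetric
filters. -/
def symQMap (h : symFilter Fl Fr ≤ symFilter Gl Gr) : SymQ Fl Fr M →+ SymQ Gl Gr M :=
  GabrielFilter.modQMap (EnvMod R M) h

theorem symQMap_toSymQ (h : symFilter Fl Fr ≤ symFilter Gl Gr) (m : M) :
    symQMap M h (toSymQ Fl Fr M m) = toSymQ Gl Gr M m := by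
  classical
  refine (AddCommGroup.DirectLimit.lift_of _ _ _ _ _).trans ?_
  rfl

end

variable (Fl : GabrielFilter R) (Fr : GabrielFilter Rᵐᵒᵖ) (Gl : GabrielFilter R)
  (Gr : GabrielFilter Rᵐᵒᵖ) (δ : R →+ R)

/-- The first symmetric filter is contained in the second one, the derivation `d` extends uniquely
to both symmetric modules of quotients, and the two extensions agree. -/
def ModuleExtensionsAgree {M : Type v} [AddCommGroup M] [Module R M] [Module Rᵐᵒᵖ M]
    [SMulCommClass R Rᵐᵒᵖ M] (d : M →+ M) : Prop :=
  ∃ h : symFilter Fl Fr ≤ symFilter Gl Gr,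
    (∃! D₁, IsModuleExtension Fl Fr δ d D₁) ∧ (∃! D₂, IsModuleExtension Gl Gr δ d D₂) ∧
    ∀ D₁ D₂, IsModuleExtension Fl Fr δ d D₁ → IsModuleExtension Gl Gr δ d D₂ →
      ∀ x, symQMap M h (D₁ x) = D₂ (symQMap M h x)

/-- The first symmetric filter is contained in the second one, the derivation `δ` extends uniquely
to both symmetric rings of quotients, and the two extensions agree. -/
def RingExtensionsAgree : Prop :=
  ∃ h : symFilter Fl Fr ≤ symFilter Gl Gr,
    (∃! D₁, IsRingExtension Fl Fr δ D₁) ∧ (∃! D₂, IsRingExtension Gl Gr δ D₂) ∧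
    ∀ D₁ D₂, IsRingExtension Fl Fr δ D₁ → IsRingExtension Gl Gr δ D₂ →
      ∀ x, symQMap R h (D₁ x) = D₂ (symQMap R h x)

end

end

/-! Over any ring `A`, every Gabriel filter is differential: if `Δ` is a derivation and `I` lies in
the filter, then `{a ∈ I | Δ a ∈ I}` is a left ideal, and for `a ∈ I` its colon by `a` contains `(I
: Δ a)`. Hence `Δ`-derivations preserve torsion. If `D` extends `d` and `a • x = q(m)`, the Leibniz
rule forces `a • D x = q(d m) - Δ a • x`. The right side defines a single-valued graph on an ideal
of the filter, which is an element of the module of quotients; this gives existence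
(`exists_derivation_modQ`). Since modules of quotients are torsion-free, the same formula gives
uniqueness and compatibility with the canonical maps (`modQMap_derivation`).

Bimodules are modules over `R ⊗ Rᵐᵒᵖ`, and `δ` induces the derivation `envDerivation δ` there, so
all of this applies to symmetric modules of quotients. For rings, bimodule extensions and ring
extensions of `δ` coincide (`isRingExtension_iff`). Consequently two extensions agree as soon as the
first symmetric filter is contained in the second, and only inclusions of filters remain: faithful
filters lie in the Lambek filter, the Lambek filter lies in the Goldie filter, and the classical
pair lies below the total pair.

The total pair is built inside the maximal symmetric ring of quotients, as the subring generated by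
`R` and all perfect rings of quotients. Having enough denominators is stable under sums and products
(`HasDenominators.add`, `HasDenominators.mul`), so this subring again has enough denominators on
both sides, which makes it perfect (`isPerfectPair_of_subring`). For a left and right Ore ring,
regular elements become invertible in the classical symmetric ring of quotients. It is therefore a
ring of fractions, hence perfect, and isomorphic to the Ore localization. -/

/-! ### Derivations and Gabriel filters -/

namespace GabrielFilter

section

variable {A : Type u} [Ring A] {F G : GabrielFilter A} {Δ : A →+ A}
  {M : Type v} [AddCommGroup M] [Module A M]

/-- Every Gabriel filter is differential: for `I` in the filter, `{a ∈ I | Δ a ∈ I}` is again a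
left ideal in the filter. -/
theorem exists_mem_derivation_le (F : GabrielFilter A) (hΔ : IsRingDerivation Δ) {I : Ideal A}
    (hI : I ∈ F) : ∃ J ∈ F, J ≤ I ∧ ∀ a ∈ J, Δ a ∈ I := by
  let J : Ideal A :=
    { carrier := {a | a ∈ I ∧ Δ a ∈ I}
      zero_mem' := by simp
      add_mem' := fun {a b} ha hb =>
        ⟨I.add_mem ha.1 hb.1, by rw [map_add]; exact I.add_mem ha.2 hb.2⟩
      smul_mem' := fun c a ha =>
        ⟨I.mul_mem_left c ha.1, by
          rw [smul_eq_mul, hΔ]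
          exact I.add_mem (I.mul_mem_left _ ha.1) (I.mul_mem_left _ ha.2)⟩ }
  refine ⟨J, F.mem_of_colon hI (fun a ha => F.mem_of_le (F.colon_mem hI (Δ a)) (fun b hb => ?_)),
    fun a ha => ha.1, fun a ha => ha.2⟩
  rw [mem_leftColon] at hb ⊢
  exact ⟨I.mul_mem_left b ha, by rw [hΔ]; exact I.add_mem (I.mul_mem_left _ ha) hb⟩

/-- Derivations of a module preserve its torsion submodule. -/
theorem derivation_mem_torsion (hΔ : IsRingDerivation Δ) {d : M →+ M}
    (hd : ∀ (a : A) (x : M), d (a • x) = Δ a • x + a • d x) {x : M} (hx : x ∈ F.torsion M) :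
    d x ∈ F.torsion M := by
  obtain ⟨J, hJ, hJx, hJΔ⟩ := F.exists_mem_derivation_le hΔ (mem_torsion.1 hx)
  refine mem_torsion.2 (F.mem_of_le hJ (fun a ha => mem_elemAnn.2 ?_))
  -- Both `a` and `Δ a` annihilate `x`, so the Leibniz rule leaves `0 = a • d x`.
  have h := hd a x
  rwa [mem_elemAnn.1 (hJx ha), mem_elemAnn.1 (hJΔ a ha), map_zero, zero_add, eq_comm] at h

/-- As `d` preserves torsion, `q(d m)` depends only on `q(m)`. This makes the graph below
single-valued. -/
theorem toModQ_derivation_congr (hΔ : IsRingDerivation Δ) {d : M →+ M}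
    (hd : ∀ (a : A) (x : M), d (a • x) = Δ a • x + a • d x) {m m' : M}
    (h : F.toModQ M m = F.toModQ M m') : F.toModQ M (d m) = F.toModQ M (d m') := by
  rw [← sub_eq_zero, ← map_sub, toModQ_eq_zero_iff] at h ⊢
  rw [← map_sub]
  exact derivation_mem_torsion hΔ hd h

/-- The value of the extended derivation at an element of the module of quotients. -/
theorem exists_derivation_value (hΔ : IsRingDerivation Δ) {d : M →+ M}
    (hd : ∀ (a : A) (x : M), d (a • x) = Δ a • x + a • d x) (x : F.ModQ M) :
    ∃ y : F.ModQ M, ∀ a m, a • x = F.toModQ M m → a • y = F.toModQ M (d m) - Δ a • x := by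
  -- The graph of `a ↦ a • D x`, with the value that the Leibniz rule forces when `a • x = q(m)`.
  let Γ : Submodule A (A × F.ModQ M) :=
    { carrier := {p | ∃ m, p.1 • x = F.toModQ M m ∧ p.2 = F.toModQ M (d m) - Δ p.1 • x}
      zero_mem' := ⟨0, by simp⟩
      add_mem' := by
        rintro p p' ⟨m, h, h'⟩ ⟨n, k, k'⟩
        refine ⟨m + n, ?_, ?_⟩
        · rw [Prod.fst_add, add_smul, h, k, map_add]
        · rw [Prod.snd_add, h', k', Prod.fst_add, map_add, map_add, map_add, add_smul]
          abel
      smul_mem' := by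
        rintro c p ⟨m, h, h'⟩
        refine ⟨c • m, ?_, ?_⟩
        · rw [Prod.smul_fst, smul_eq_mul, mul_smul, h, map_smul]
        -- The terms `Δ c • q(m)`, from `d (c • m)`, and `Δ c • a • x`, from `Δ (c * a) • x`, cancel
        -- because `a • x = q(m)`.
        · rw [Prod.smul_snd, h', Prod.smul_fst, smul_eq_mul, hΔ, hd, map_add, map_smul, map_smul,
            add_smul, mul_smul, mul_smul, h, smul_sub]
          abel }
  obtain ⟨K, hK, hKx⟩ := exists_smul_mem x
  -- Over `a = 0` the element `m` is torsion, hence so is `d m`, and the prescribed value is zero.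
  obtain ⟨y, hy⟩ := exists_of_graph Γ (by
    rintro n ⟨m, h, h'⟩
    have h0 : F.toModQ M m = F.toModQ M 0 := by rw [← h, zero_smul, map_zero]
    change n = F.toModQ M (d m) - Δ 0 • x at h'
    rw [h', toModQ_derivation_congr hΔ hd h0]
    simp) K hK (fun k hk => by
      obtain ⟨m, hm⟩ := hKx k hk
      exact ⟨F.toModQ M (d m) - Δ k • x, m, hm, rfl⟩)
  exact ⟨y, fun a m h => hy _ _ ⟨m, h, rfl⟩⟩

/-- A derivation of a module extends to its module of quotients. -/
theorem exists_derivation_modQ (F : GabrielFilter A) (hΔ : IsRingDerivation Δ) {d : M →+ M}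
    (hd : ∀ (a : A) (x : M), d (a • x) = Δ a • x + a • d x) :
    ∃ D : F.ModQ M →+ F.ModQ M, (∀ a x, D (a • x) = Δ a • x + a • D x) ∧
      ∀ m, D (F.toModQ M m) = F.toModQ M (d m) := by
  choose D hD using exists_derivation_value (F := F) hΔ hd
  refine ⟨AddMonoidHom.mk' D (fun x y => ?_), fun a x => ?_, fun m => ?_⟩
  · obtain ⟨K, hK, hx⟩ := exists_smul_mem x
    obtain ⟨L, hL, hy⟩ := exists_smul_mem y
    refine modQ_ext (F.inf_mem hK hL) (fun k hk => ?_)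
    obtain ⟨m, hm⟩ := hx k hk.1
    obtain ⟨n, hn⟩ := hy k hk.2
    rw [smul_add, hD x k m hm, hD y k n hn,
      hD (x + y) k (m + n) (by rw [smul_add, hm, hn, map_add]), map_add, map_add, smul_add]
    abel
  · obtain ⟨K, hK, hx⟩ := exists_smul_mem x
    refine modQ_ext (F.colon_mem hK a) (fun k hk => ?_)
    -- The same `m` serves the pairs `(k, a • x)` and `(k * a, x)`. Comparing the two defining
    -- formulas, with `Δ (k * a)` expanded, gives the Leibniz rule multiplied by `k`.
    obtain ⟨m, hm⟩ := hx _ (mem_leftColon.1 hk)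
    have h1 := hD (a • x) k m (by rw [← mul_smul, hm])
    have h2 := hD x (k * a) m hm
    rw [hΔ, add_smul, mul_smul, mul_smul, mul_smul] at h2
    change k • D (a • x) = k • (Δ a • x + a • D x)
    rw [h1, smul_add, h2]
    abel
  · have h := hD (F.toModQ M m) 1 m (one_smul _ _)
    have h1 : Δ 1 = 0 := by simpa using hΔ 1 1
    rwa [one_smul, h1, zero_smul, sub_zero] at h

theorem modQMap_germ (h : F ≤ G) (K : F.Index) (φ : F.HomTF M K) :
    modQMap M h (F.germ M K φ) =
      G.germ M (G.idx K.ideal (h _ K.mem)) (tfQuotMap M h ∘ₗ φ) := by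
  classical
  exact AddCommGroup.DirectLimit.lift_of _ _ _ K φ

theorem modQMap_smul (h : F ≤ G) (a : A) (x : F.ModQ M) :
    modQMap M h (a • x) = a • modQMap M h x := by
  obtain ⟨K, φ, rfl⟩ := exists_germ x
  rw [smul_germ, modQMap_germ, modQMap_germ, smul_germ]
  exact germ_eq _ _ _ _ ⊤ G.top_mem (fun b _ h1 h2 => rfl)

theorem modQMap_toModQ (h : F ≤ G) (m : M) : modQMap M h (F.toModQ M m) = G.toModQ M m :=
  (modQMap_germ h _ _).trans rfl

/-- Extensions of a derivation to modules of quotients commute with the canonical maps. -/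
theorem modQMap_derivation (h : F ≤ G) {d : M →+ M} {D₁ : F.ModQ M →+ F.ModQ M}
    {D₂ : G.ModQ M →+ G.ModQ M} (h₁ : ∀ a x, D₁ (a • x) = Δ a • x + a • D₁ x)
    (h₁' : ∀ m, D₁ (F.toModQ M m) = F.toModQ M (d m))
    (h₂ : ∀ a x, D₂ (a • x) = Δ a • x + a • D₂ x)
    (h₂' : ∀ m, D₂ (G.toModQ M m) = G.toModQ M (d m)) (x : F.ModQ M) :
    modQMap M h (D₁ x) = D₂ (modQMap M h x) := by
  obtain ⟨K, hK, hx⟩ := exists_smul_mem x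
  refine modQ_ext (h _ hK) (fun k hk => ?_)
  obtain ⟨m, hm⟩ := hx k hk
  -- Both sides have the same product with `k`: each Leibniz rule expresses it through `m` and `Δ
  -- k`, and the canonical map respects both.
  have e₁ := h₁ k x
  have e₂ := h₂ k (modQMap M h x)
  rw [hm, h₁'] at e₁
  rw [← modQMap_smul, hm, modQMap_toModQ, h₂', ← modQMap_toModQ h, e₁, map_add, modQMap_smul,
    modQMap_smul] at e₂
  exact add_left_cancel e₂

end

end GabrielFilter

/-! ### Extensions to symmetric modules of quotients -/

section

variable {R : Type u} [Ring R] {δ : R →+ R}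

theorem envDerivation_tmul (δ : R →+ R) (r : R) (s : Rᵐᵒᵖ) :
    envDerivation δ (r ⊗ₜ[ℤ] s) = δ r ⊗ₜ[ℤ] s + r ⊗ₜ[ℤ] op (δ (unop s)) := rfl

/-- This is the input that reduces bimodules to one-sided modules over the enveloping ring.
Additivity in both factors leaves only pure tensors to check. -/
theorem isRingDerivation_envDerivation (hδ : IsRingDerivation δ) :
    IsRingDerivation (envDerivation δ) := by
  have h : ∀ r s, δ (r * s) = δ r * s + r * δ s := hδ
  intro a b
  induction a using TensorProduct.induction_on with
  | zero => simp
  | add x y hx hy => rw [add_mul, map_add, hx, hy, map_add, add_mul, add_mul]; abel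
  | tmul r s =>
    induction b using TensorProduct.induction_on with
    | zero => simp
    | add x y hx hy => rw [mul_add, map_add, hx, hy, map_add, mul_add, mul_add]; abel
    | tmul r' s' =>
      simp only [envDerivation_tmul, Algebra.TensorProduct.tmul_mul_tmul, add_mul, mul_add, h,
        TensorProduct.add_tmul, TensorProduct.tmul_add, unop_mul, op_add, op_mul, op_unop]
      abel

variable {Fl Gl : GabrielFilter R} {Fr Gr : GabrielFilter Rᵐᵒᵖ}
  {M : Type v} [AddCommGroup M] [Module R M] [Module Rᵐᵒᵖ M] [SMulCommClass R Rᵐᵒᵖ M]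
  {d : M →+ M}

theorem IsRingDerivation.map_one (hδ : IsRingDerivation δ) : δ 1 = 0 := by simpa using hδ 1 1

variable (R) in
/-- An additive endomorphism of `M`, considered on the copy of `M`. -/
def envModMap (d : M →+ M) : EnvMod R M →+ EnvMod R M := d

/-- The left and the right Leibniz rule, applied one after the other to `r • s • x`, combine into
one rule over the enveloping ring. -/
theorem IsBimoduleDerivation.smul_envMod (hd : IsBimoduleDerivation δ d) (a : Env R)
    (x : EnvMod R M) :
    envModMap R d (a • x) = envDerivation δ a • x + a • envModMap R d x := by
  induction a using TensorProduct.induction_on with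
  | zero =>
    have h : ∀ y : EnvMod R M, (0 : Env R) • y = 0 := fun y => zero_smul (Env R) y
    rw [map_zero, h, h, map_zero, add_zero]
  | add a b ha hb => rw [add_smul, map_add, ha, hb, map_add, add_smul, add_smul]; abel
  | tmul r s =>
    rw [envDerivation_tmul, add_smul]
    obtain ⟨x, rfl⟩ : ∃ y : M, toEnvMod R M y = x := ⟨x, rfl⟩
    change d (r • s • x) = δ r • s • x + r • op (δ (unop s)) • x + r • s • d x
    rw [hd.left, ← op_unop s, hd.right, smul_add, op_unop]
    abel

theorem IsBimoduleDerivation.smul_symQ {D : SymQ Fl Fr M →+ SymQ Fl Fr M}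
    (hD : IsBimoduleDerivation δ D) (a : Env R) (x : SymQ Fl Fr M) :
    D (a • x) = envDerivation δ a • x + a • D x := by
  induction a using TensorProduct.induction_on with
  | zero =>
    have h : ∀ y : SymQ Fl Fr M, (0 : Env R) • y = 0 := fun y => zero_smul (Env R) y
    rw [map_zero, h, h, map_zero, add_zero]
  | add a b ha hb => rw [add_smul, map_add, ha, hb, map_add, add_smul, add_smul]; abel
  | tmul r s =>
    rw [envDerivation_tmul, add_smul, tmul_smul_symQ, tmul_smul_symQ, tmul_smul_symQ,
      tmul_smul_symQ, hD.left, ← op_unop s, hD.right, smul_add, op_unop]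
    abel

theorem isModuleExtension_agree (h : symFilter Fl Fr ≤ symFilter Gl Gr)
    {D₁ : SymQ Fl Fr M →+ SymQ Fl Fr M} {D₂ : SymQ Gl Gr M →+ SymQ Gl Gr M}
    (h₁ : IsModuleExtension Fl Fr δ d D₁) (h₂ : IsModuleExtension Gl Gr δ d D₂)
    (x : SymQ Fl Fr M) : symQMap M h (D₁ x) = D₂ (symQMap M h x) :=
  GabrielFilter.modQMap_derivation (M := EnvMod R M) h (fun a x => h₁.deriv.smul_symQ a x) h₁.comm
    (fun a x => h₂.deriv.smul_symQ a x) h₂.comm x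

theorem symQMap_smul (h : symFilter Fl Fr ≤ symFilter Gl Gr) (a : Env R) (x : SymQ Fl Fr M) :
    symQMap M h (a • x) = a • symQMap M h x :=
  GabrielFilter.modQMap_smul (M := EnvMod R M) h a x

theorem symQMap_left_smul (h : symFilter Fl Fr ≤ symFilter Gl Gr) (r : R) (x : SymQ Fl Fr M) :
    symQMap M h (r • x) = r • symQMap M h x := symQMap_smul h _ x

theorem symQMap_right_smul (h : symFilter Fl Fr ≤ symFilter Gl Gr) (s : Rᵐᵒᵖ)
    (x : SymQ Fl Fr M) : symQMap M h (s • x) = s • symQMap M h x := symQMap_smul h _ x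

theorem symQ_ext_of_filter {x y : SymQ Fl Fr M} {K : Ideal (Env R)} (hK : K ∈ symFilter Fl Fr)
    (h : ∀ k ∈ K, k • x = k • y) : x = y :=
  GabrielFilter.modQ_ext (F := symFilter Fl Fr) (M := EnvMod R M) hK h

variable (Fl Fr) in
/-- Derivations of bimodules extend uniquely to the symmetric modules of quotients. -/
theorem existsUnique_isModuleExtension (hδ : IsRingDerivation δ) (hd : IsBimoduleDerivation δ d) :
    ∃! D, IsModuleExtension Fl Fr δ d D := by
  obtain ⟨D, hD, hD'⟩ := (symFilter Fl Fr).exists_derivation_modQ (M := EnvMod R M)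
    (isRingDerivation_envDerivation hδ) hd.smul_envMod
  refine ⟨D, ⟨⟨fun r x => ?_, fun r x => ?_⟩, hD'⟩, fun D' h' => ?_⟩
  -- The one-sided rules are recovered from the tensors `r ⊗ 1` and `1 ⊗ r`; the other term vanishes
  -- since `δ 1 = 0`.
  · refine (hD (r ⊗ₜ[ℤ] 1) x).trans ?_
    rw [envDerivation_tmul, unop_one, hδ.map_one, op_zero, TensorProduct.tmul_zero, add_zero]
    rfl
  · refine (hD (1 ⊗ₜ[ℤ] op r) x).trans ?_
    rw [envDerivation_tmul, unop_op, hδ.map_one, TensorProduct.zero_tmul, zero_add, add_comm]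
    rfl
  · ext x
    obtain ⟨K, hK, hx⟩ := GabrielFilter.exists_smul_mem x
    refine symQ_ext_of_filter hK (fun k hk => ?_)
    obtain ⟨m, hm⟩ := hx k hk
    have e₁ := h'.deriv.smul_symQ k x
    have e₂ := hD k x
    -- Two extensions coincide on `q(M)`, so by the Leibniz rule `D' x` and `D x` have equal
    -- multiples by every `k ∈ K`.
    have e₃ : D' (k • x) = D (k • x) :=
      (congrArg D' hm).trans ((h'.comm m).trans ((congrArg D hm).trans (hD' m)).symm)
    exact add_left_cancel (e₁.symm.trans (e₃.trans e₂))

/-- Existence, uniqueness and compatibility hold for every pair of filters, so an inclusion of the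
symmetric filters is the only thing left to establish. -/
theorem moduleExtensionsAgree_of_le (h : symFilter Fl Fr ≤ symFilter Gl Gr)
    (hδ : IsRingDerivation δ) (hd : IsBimoduleDerivation δ d) :
    ModuleExtensionsAgree Fl Fr Gl Gr δ d :=
  ⟨h, existsUnique_isModuleExtension Fl Fr hδ hd, existsUnique_isModuleExtension Gl Gr hδ hd,
    fun _ _ h₁ h₂ => isModuleExtension_agree h h₁ h₂⟩

/-! ### Extensions to symmetric rings of quotients -/

theorem IsRingDerivation.isBimoduleDerivation (hδ : IsRingDerivation δ) :
    IsBimoduleDerivation δ δ where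
  left r x := hδ r x
  right r x := hδ x r

/-- Extensions of a derivation to the symmetric ring of quotients are the same, whether it is
considered as a ring or as a bimodule. -/
theorem isRingExtension_iff {D : SymRing Fl Fr →+ SymRing Fl Fr} :
    IsRingExtension Fl Fr δ D ↔ IsModuleExtension Fl Fr δ δ D := by
  constructor
  · rintro ⟨hD, hD'⟩
    have hq : ∀ r, D (toSymQ Fl Fr R r) = toSymQ Fl Fr R (δ r) := hD'
    refine ⟨⟨fun r x => ?_, fun r x => ?_⟩, hD'⟩
    · rw [← toSymQ_mul', hD, hq, toSymQ_mul', toSymQ_mul']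
    · rw [← mul_toSymQ', hD, hq, mul_toSymQ', mul_toSymQ']
  · rintro ⟨hD, hq⟩
    -- The product rule is tested on multiples by `i` with `i x = q(r)`: expand `D (i (x y)) = D (r
    -- y)` both ways and use `q(δ r) = D (i x)`. On the right, elements `j` with `y j = q(s)` play
    -- the same role.
    refine ⟨fun x y => ?_, hq⟩
    obtain ⟨I, hI, hx⟩ := exists_left_smul_mem x
    obtain ⟨J, hJ, hy⟩ := exists_right_smul_mem y
    refine symQ_ext hI hJ (fun i hi => ?_) (fun j hj => ?_)
    · obtain ⟨r, hr⟩ := hx i hi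
      have e₁ := hD.left i (x * y)
      have e₂ := hD.left i x
      rw [hr, hq] at e₂
      rw [← left_smul_mul', hr, toSymQ_mul', hD.left, ← toSymQ_mul' (δ r) y, e₂, add_mul,
        left_smul_mul', left_smul_mul', add_assoc] at e₁
      rw [← add_left_cancel e₁, smul_add, ← left_smul_mul' i x, hr, toSymQ_mul']
    · obtain ⟨s, hs⟩ := hy j hj
      obtain ⟨j, rfl⟩ := op_surjective j
      have e₁ := hD.right j (x * y)
      have e₂ := hD.right j y
      rw [hs, hq] at e₂
      rw [← mul_right_smul', hs, mul_toSymQ', hD.right, ← mul_toSymQ' x (δ s), e₂, mul_add,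
        mul_right_smul', mul_right_smul', ← add_assoc] at e₁
      rw [← add_right_cancel e₁, smul_add, ← mul_right_smul' (op j) (D x) y, hs, mul_toSymQ']

theorem ringExtensionsAgree_of_le (h : symFilter Fl Fr ≤ symFilter Gl Gr)
    (hδ : IsRingDerivation δ) : RingExtensionsAgree Fl Fr Gl Gr δ := by
  obtain ⟨h', h₁, h₂, h₁₂⟩ := moduleExtensionsAgree_of_le h hδ hδ.isBimoduleDerivation
  simp only [← isRingExtension_iff] at h₁ h₂ h₁₂
  exact ⟨h', h₁, h₂, h₁₂⟩

/-! ### Comparison of filters -/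

theorem symFilter_mono (hl : Fl ≤ Gl) (hr : Fr ≤ Gr) : symFilter Fl Fr ≤ symFilter Gl Gr := by
  rintro K ⟨I, hI, J, hJ, h⟩
  exact ⟨I, hl I hI, J, hr J hJ, h⟩

end

section

variable {A : Type u} [Ring A]

theorem GabrielFilter.IsFaithful.eq_zero {F : GabrielFilter A} (hF : F.IsFaithful) {I : Ideal A}
    (hI : I ∈ F) {x : A} (h : ∀ i ∈ I, i * x = 0) : x = 0 := by
  have hx : x ∈ F.torsion A := F.mem_of_le hI (fun i hi => mem_elemAnn.2 (h i hi))
  rw [GabrielFilter.IsFaithful] at hF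
  rwa [hF] at hx

theorem GabrielFilter.IsFaithful.of_eq_zero {F : GabrielFilter A}
    (h : ∀ I ∈ F, ∀ x : A, (∀ i ∈ I, i * x = 0) → x = 0) : F.IsFaithful :=
  (Submodule.eq_bot_iff _).2 (fun x hx => h _ hx x (fun _ hi => mem_elemAnn.1 hi))

/-- If density failed for `x` and `y ≠ 0`, the ideal `(I : x)` of the filter would annihilate `y`,
contradicting faithfulness. -/
theorem GabrielFilter.IsFaithful.le_lambekFilter {F : GabrielFilter A} (hF : F.IsFaithful) :
    F ≤ lambekFilter A := by
  intro I hI x y hy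
  by_contra! h
  exact hy (hF.eq_zero (F.colon_mem hI x) (fun i hi => h i (mem_leftColon.1 hi)))

variable (A) in
theorem lambekFilter_isFaithful : (lambekFilter A).IsFaithful := by
  refine GabrielFilter.IsFaithful.of_eq_zero (fun I hI x hx => ?_)
  by_contra h
  obtain ⟨r, hr, hr'⟩ := hI 1 x h
  exact hr' (hx r (by simpa using hr))

variable (A) in
theorem lambekFilter_le_goldieFilter : lambekFilter A ≤ goldieFilter A := by
  -- Density for a pair of equal elements is essentiality. The colon ideals of a dense ideal are
  -- dense again, so `J = I` witnesses membership in the Goldie filter.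
  have hess : ∀ I ∈ lambekFilter A, IsEssentialIdeal I := fun I hI a ha => hI a a ha
  exact fun I hI => ⟨I, hess I hI, fun j _ => hess _ ((lambekFilter A).colon_mem hI j)⟩

variable (A) in
theorem classicalFilter_isFaithful : (classicalFilter A).IsFaithful := by
  refine GabrielFilter.IsFaithful.of_eq_zero (fun I hI x hx => ?_)
  obtain ⟨t, ht, h⟩ := hI 1
  rw [mul_one] at h
  exact (mem_nonZeroDivisors_iff.1 ht).1 x (hx t h)

end

/-! ### Perfect ring homomorphisms -/

section

variable {A : Type u} [Ring A] {S : Type v} [Ring S] {T : Type w} [Ring T]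

/-- The left ideal of all `a` with `f(a) s ∈ f(I)`. -/
def denominators (f : A →+* S) (I : Ideal A) (s : S) : Ideal A where
  carrier := {a | ∃ b ∈ I, f a * s = f b}
  zero_mem' := ⟨0, I.zero_mem, by simp⟩
  add_mem' := by
    rintro a a' ⟨b, hb, h⟩ ⟨b', hb', h'⟩
    exact ⟨b + b', I.add_mem hb hb', by rw [map_add, add_mul, h, h', map_add]⟩
  smul_mem' := by
    rintro c a ⟨b, hb, h⟩
    exact ⟨c * b, I.mul_mem_left c hb, by rw [smul_eq_mul, map_mul, mul_assoc, h, map_mul]⟩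

theorem mem_denominators {f : A →+* S} {I : Ideal A} {s : S} {a : A} :
    a ∈ denominators f I s ↔ ∃ b ∈ I, f a * s = f b := Iff.rfl

theorem map_eq_top_of_le {f : A →+* S} {I J : Ideal A} (hJ : J.map f = ⊤) (h : J ≤ I) :
    I.map f = ⊤ := top_unique (hJ ▸ Ideal.map_mono h)

/-- For `a ∈ J` the elements `f b` with `b * a ∈ I` generate `S` and multiply `f a` into `S f(I)`.
Hence `f a` lies there, and so does everything that `f(J)` generates. -/
theorem map_eq_top_of_leftColon {f : A →+* S} {I J : Ideal A} (hJ : J.map f = ⊤)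
    (h : ∀ a ∈ J, (leftColon I a).map f = ⊤) : I.map f = ⊤ := by
  rw [eq_top_iff, ← hJ, Ideal.map_le_iff_le_comap]
  intro a ha
  have hle : (leftColon I a).map f ≤ leftColon (I.map f) (f a) :=
    Ideal.map_le_iff_le_comap.2 (fun b hb => by
      rw [Ideal.mem_comap, mem_leftColon, ← map_mul]
      exact Ideal.mem_map_of_mem f (mem_leftColon.1 hb))
  rw [h a ha] at hle
  have h1 : (1 : S) ∈ leftColon (I.map f) (f a) := hle trivial
  rwa [mem_leftColon, one_mul] at h1

/-- For every `a`, the elements that multiply `f(a) s` into `f(I)` generate `S` as a left ideal. -/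
def HasDenominators (f : A →+* S) (I : Ideal A) (s : S) : Prop :=
  ∀ a : A, (denominators f I (f a * s)).map f = ⊤

theorem hasDenominators_of_mem {f : A →+* S} {I : Ideal A} {b : A} (hb : b ∈ I) :
    HasDenominators f I (f b) := fun a =>
  map_eq_top_of_le (Ideal.map_top f) (fun c _ =>
    mem_denominators.2 ⟨c * (a * b), I.mul_mem_left _ (I.mul_mem_left _ hb), by simp⟩)

/-- If `r` is a denominator of `f a * s` and `c` one of `f (r * a) * t`, then `c * r` is one of `f a
* (s + t)`. The condition for `t` is needed at `r * a`, which is why it is imposed for all elements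
of `A`. -/
theorem HasDenominators.add {f : A →+* S} {I : Ideal A} {s t : S} (hs : HasDenominators f I s)
    (ht : HasDenominators f I t) : HasDenominators f I (s + t) := fun a => by
  refine map_eq_top_of_leftColon (hs a) (fun r hr => map_eq_top_of_le (ht (r * a)) ?_)
  rintro c ⟨b, hb, h⟩
  obtain ⟨b', hb', h'⟩ := hr
  refine mem_leftColon.2 ⟨c * b' + b, I.add_mem (I.mul_mem_left c hb') hb, ?_⟩
  rw [RingHom.map_add f, ← h, RingHom.map_mul f c b', ← h']
  simp only [map_mul, mul_add, mul_assoc]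

/-- A denominator `r` turns `f a * s` into a numerator `f b'`; a denominator `c` of `f b' * t` then
makes `c * r` one of `f a * (s * t)`. -/
theorem HasDenominators.mul {f : A →+* S} {I : Ideal A} {s t : S} (hs : HasDenominators f ⊤ s)
    (ht : HasDenominators f I t) : HasDenominators f I (s * t) := fun a => by
  refine map_eq_top_of_leftColon (hs a) (fun r hr => ?_)
  obtain ⟨b', -, h'⟩ := hr
  refine map_eq_top_of_le (ht b') ?_
  rintro c ⟨b, hb, h⟩
  refine mem_leftColon.2 ⟨b, hb, ?_⟩
  rw [← h, ← h']
  simp only [map_mul, mul_assoc]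

theorem HasDenominators.comp {f : A →+* S} {I : Ideal A} {s : S} (hs : HasDenominators f I s)
    (φ : S →+* T) : HasDenominators (φ.comp f) I (φ s) := fun a => by
  have h : (denominators f I (f a * s)).map (φ.comp f) = ⊤ := by
    rw [← Ideal.map_map, hs a, Ideal.map_top]
  refine map_eq_top_of_le h ?_
  rintro c ⟨b, hb, h⟩
  exact ⟨b, hb, by simp only [RingHom.comp_apply, ← h, map_mul]⟩

/-- The elements of `S` that are multiplied into the image of `f` by sufficiently many elements. -/
def denominatorSubring (f : A →+* S) : Subring S where
  carrier := {s | HasDenominators f ⊤ s}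
  zero_mem' := by simpa using hasDenominators_of_mem (f := f) (Submodule.zero_mem ⊤)
  one_mem' := by simpa using hasDenominators_of_mem (f := f) (I := ⊤) (b := 1) trivial
  add_mem' := HasDenominators.add
  mul_mem' := HasDenominators.mul
  neg_mem' := fun {s} hs => by
    have h := (hasDenominators_of_mem (f := f) (I := ⊤) (b := -1) trivial).mul hs
    rwa [map_neg, map_one, neg_one_mul] at h

/-- Every element of `S` is multiplied into the image of `f` by sufficiently many elements. -/
def IsPerfectHom (f : A →+* S) : Prop := ∀ s : S, HasDenominators f ⊤ s

/-- Here perfectness enters. Writing `1` as a combination of elements of `f(I)` with coefficients in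
`S` shows that `1` has denominators with numerators in `I`. By injectivity, such a denominator of `f
a * 1` is an element of `(I : a)`. -/
theorem IsPerfectHom.map_leftColon {f : A →+* S} (hf : IsPerfectHom f)
    (hinj : Function.Injective f) {I : Ideal A} (hI : I.map f = ⊤) (a : A) :
    (leftColon I a).map f = ⊤ := by
  have h : ∀ y ∈ I.map f, HasDenominators f I y := by
    intro y hy
    induction hy using Submodule.span_induction with
    | mem y hy =>
      obtain ⟨i, hi, rfl⟩ := hy
      exact hasDenominators_of_mem hi
    | zero => simpa using hasDenominators_of_mem (f := f) I.zero_mem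
    | add y z _ _ hy hz => exact hy.add hz
    | smul s y _ hy => exact (hf s).mul hy
  refine map_eq_top_of_le (h 1 (hI ▸ trivial) a) ?_
  rintro c ⟨b, hb, h'⟩
  rw [mul_one, ← map_mul] at h'
  rw [mem_leftColon, hinj h']
  exact hb

/-- The Gabriel filter `{I | S f(I) = S}` of an injective perfect homomorphism. -/
def perfectFilter (f : A →+* S) (hinj : Function.Injective f) (hf : IsPerfectHom f) :
    GabrielFilter A where
  ideals := {I | I.map f = ⊤}
  top_mem := Ideal.map_top f
  mem_of_le := map_eq_top_of_le
  inf_mem := fun hI hJ => map_eq_top_of_leftColon hI (fun a ha =>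
    map_eq_top_of_le (hf.map_leftColon hinj hJ a) (fun b hb =>
      mem_leftColon.2 ⟨Ideal.mul_mem_left _ b ha, mem_leftColon.1 hb⟩))
  colon_mem := fun hI a => hf.map_leftColon hinj hI a
  mem_of_colon := map_eq_top_of_leftColon

/-- If `I` annihilates `x`, the annihilator of `f x` in `S` contains `S f(I) = S`, so `f x = 0`. -/
theorem perfectFilter_isFaithful {f : A →+* S} (hinj : Function.Injective f)
    (hf : IsPerfectHom f) : (perfectFilter f hinj hf).IsFaithful := by
  refine GabrielFilter.IsFaithful.of_eq_zero (fun I hI x hx => ?_)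
  have hle : I.map f ≤ elemAnn S (f x) := Ideal.map_le_iff_le_comap.2 (fun i hi => by
    rw [Ideal.mem_comap, mem_elemAnn, smul_eq_mul, ← map_mul, hx i hi, map_zero])
  rw [show I.map f = ⊤ from hI] at hle
  have h1 : (1 : S) ∈ elemAnn S (f x) := hle trivial
  rw [mem_elemAnn, one_smul] at h1
  exact hinj (h1.trans (map_zero f).symm)

end

/-! ### Homomorphisms between symmetric rings of quotients -/

section

variable {R : Type u} [Ring R] {Fl Gl : GabrielFilter R} {Fr Gr : GabrielFilter Rᵐᵒᵖ}

theorem toSymRing_mul (r : R) (x : SymRing Fl Fr) : toSymRing Fl Fr r * x = r • x :=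
  toSymQ_mul' r x

theorem mul_toSymRing (r : R) (x : SymRing Fl Fr) : x * toSymRing Fl Fr r = op r • x :=
  mul_toSymQ' x r

/-- Elements of the kernel are torsion on both sides, so faithfulness on the left suffices. -/
theorem toSymQ_injective (h : Fl.IsFaithful) : Function.Injective (toSymQ Fl Fr R) := by
  refine (injective_iff_map_eq_zero _).2 (fun r hr => ?_)
  obtain ⟨⟨K, hK, hKr⟩, -⟩ := ext_of_toSymQ (hr.trans (map_zero (toSymQ Fl Fr R)).symm)
  exact h.eq_zero hK (fun k hk => by rw [hKr k hk, mul_zero])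

/-- The canonical map between symmetric rings of quotients as a ring homomorphism. -/
noncomputable def symRingMap (hl : Fl ≤ Gl) (hr : Fr ≤ Gr) : SymRing Fl Fr →+* SymRing Gl Gr where
  __ := symQMap R (symFilter_mono hl hr)
  map_one' := symQMap_toSymQ R _ 1
  map_mul' x y := by
    set h := symFilter_mono hl hr
    change symQMap R h (x * y) = symQMap R h x * symQMap R h y
    obtain ⟨I, hI, hx⟩ := exists_left_smul_mem x
    obtain ⟨J, hJ, hy⟩ := exists_right_smul_mem y
    -- A product is determined by its equations on ideals of the filters. Those of the smaller
    -- filters also belong to the larger ones.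
    refine IsSymProd.unique (isSymProd_of_ideals (hl I hI) (hr J hJ) (fun i hi => ?_)
      (fun j hj => ?_)) (isSymProd_mul _ _)
    · obtain ⟨m, hm⟩ := hx i hi
      exact ⟨m, by rw [← symQMap_left_smul, hm, symQMap_toSymQ], by
        rw [← symQMap_left_smul, (isSymProd_mul x y).1 i m hm, symQMap_left_smul]⟩
    · obtain ⟨m, hm⟩ := hy j hj
      exact ⟨m, by rw [← symQMap_right_smul, hm, symQMap_toSymQ], by
        rw [← symQMap_right_smul, (isSymProd_mul x y).2 j m hm, symQMap_right_smul]⟩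

variable (hl : Fl ≤ Gl) (hr : Fr ≤ Gr)

theorem symRingMap_left_smul (r : R) (x : SymRing Fl Fr) :
    symRingMap hl hr (r • x) = r • symRingMap hl hr x := symQMap_left_smul _ r x

theorem symRingMap_right_smul (s : Rᵐᵒᵖ) (x : SymRing Fl Fr) :
    symRingMap hl hr (s • x) = s • symRingMap hl hr x := symQMap_right_smul _ s x

theorem symRingMap_toSymQ (r : R) : symRingMap hl hr (toSymQ Fl Fr R r) = toSymQ Gl Gr R r :=
  symQMap_toSymQ R _ r

/-- If `x` maps to zero and `i x = q(m)`, then `m` maps to zero in the larger ring, so `m = 0`. Thus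
`x` is killed by ideals of both filters. -/
theorem symRingMap_injective (h : Gl.IsFaithful) : Function.Injective (symRingMap hl hr) := by
  refine (injective_iff_map_eq_zero _).2 (fun x hx => ?_)
  have h0 : ∀ r, toSymQ Gl Gr R r = 0 → r = 0 := fun r hr =>
    toSymQ_injective h (hr.trans (map_zero _).symm)
  obtain ⟨I, hI, hxI⟩ := exists_left_smul_mem x
  obtain ⟨J, hJ, hxJ⟩ := exists_right_smul_mem x
  refine symQ_eq_zero hI hJ (fun i hi => ?_) (fun j hj => ?_)
  · obtain ⟨m, hm⟩ := hxI i hi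
    rw [hm, h0 m (by rw [← symRingMap_toSymQ hl hr, ← hm, symRingMap_left_smul, hx, smul_zero]),
      map_zero]
  · obtain ⟨m, hm⟩ := hxJ j hj
    rw [hm, h0 m (by rw [← symRingMap_toSymQ hl hr, ← hm, symRingMap_right_smul, hx, smul_zero]),
      map_zero]

/-- Elements of the larger ring of quotients whose ideals of denominators belong to the smaller
filters come from the smaller ring of quotients. -/
theorem exists_symRingMap_eq (h : Gl.IsFaithful) {x : SymRing Gl Gr} {I : Ideal R}
    {J : Ideal Rᵐᵒᵖ} (hI : I ∈ Fl) (hJ : J ∈ Fr) (hx : ∀ i ∈ I, ∃ m, i • x = toSymQ Gl Gr R m)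
    (hx' : ∀ j ∈ J, ∃ m, j • x = toSymQ Gl Gr R m) : ∃ y, symRingMap hl hr y = x := by
  classical
  have hinj := toSymQ_injective (Fr := Gr) h
  -- The inverse of the embedding of `R`, followed by the map to the smaller ring. The default value
  -- `0` never matters, as `φ` is evaluated only at multiples of `x` that lie in the image of `R`.
  let φ : SymRing Gl Gr → SymRing Fl Fr := fun z =>
    if h : ∃ m, z = toSymQ Gl Gr R m then toSymQ Fl Fr R h.choose else 0
  have hφ : ∀ z m, z = toSymQ Gl Gr R m → φ z = toSymQ Fl Fr R m := by
    intro z m hz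
    have hz' : ∃ m, z = toSymQ Gl Gr R m := ⟨m, hz⟩
    simp only [φ, dif_pos hz']
    rw [hinj (hz'.choose_spec.symm.trans hz)]
  obtain ⟨y, hy, hy'⟩ := exists_of_pair hI hJ (fun i => φ (i • x)) (fun j => φ (j • x))
    (by
      intro a ha b hb
      obtain ⟨m, hm⟩ := hx a ha
      obtain ⟨n, hn⟩ := hx b hb
      rw [hφ _ _ hm, hφ _ _ hn, ← map_add]
      exact hφ _ _ (by rw [add_smul, hm, hn, map_add]))
    (by
      intro r a ha
      obtain ⟨m, hm⟩ := hx a ha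
      rw [hφ _ _ hm, ← toSymQ_left_smul]
      exact hφ _ _ (by rw [mul_smul, hm, toSymQ_left_smul]))
    (by
      intro a ha b hb
      obtain ⟨m, hm⟩ := hx' a ha
      obtain ⟨n, hn⟩ := hx' b hb
      rw [hφ _ _ hm, hφ _ _ hn, ← map_add]
      exact hφ _ _ (by rw [add_smul, hm, hn, map_add]))
    (by
      intro r a ha
      obtain ⟨m, hm⟩ := hx' a ha
      rw [hφ _ _ hm, ← toSymQ_right_smul]
      exact hφ _ _ (by rw [mul_smul, hm, toSymQ_right_smul]))
    (by
      intro i hi j hj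
      obtain ⟨m, hm⟩ := hx i hi
      obtain ⟨n, hn⟩ := hx' j hj
      rw [hφ _ _ hm, hφ _ _ hn, ← toSymQ_left_smul, ← toSymQ_right_smul]
      congr 1
      refine hinj ?_
      rw [toSymQ_right_smul, ← hm, toSymQ_left_smul, ← hn, smul_comm])
  refine ⟨y, symQ_ext (hl I hI) (hr J hJ) (fun i hi => ?_) (fun j hj => ?_)⟩
  · obtain ⟨m, hm⟩ := hx i hi
    rw [← symRingMap_left_smul, hy i hi, hφ _ _ hm, symRingMap_toSymQ, hm]
  · obtain ⟨m, hm⟩ := hx' j hj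
    rw [← symRingMap_right_smul, hy' j hj, hφ _ _ hm, symRingMap_toSymQ, hm]

/-- Every `a • x` is carried into the image of `R` by an ideal of the filter, and such an ideal
generates the whole ring by assumption. -/
theorem isPerfectHom_toSymRing (h : ∀ I ∈ Fl, I.map (toSymRing Fl Fr) = ⊤) :
    IsPerfectHom (toSymRing Fl Fr) := fun x a => by
  obtain ⟨I, hI, hx⟩ := exists_left_smul_mem (a • x)
  refine map_eq_top_of_le (h I hI) (fun i hi => ?_)
  obtain ⟨m, hm⟩ := hx i hi
  exact ⟨m, trivial, by rw [toSymRing_mul, toSymRing_mul, hm]; rfl⟩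

theorem isPerfectHom_op_toSymRing
    (h : ∀ J ∈ Fr, J.map (RingHom.op (toSymRing Fl Fr)) = ⊤) :
    IsPerfectHom (RingHom.op (toSymRing Fl Fr)) := fun x a => by
  obtain ⟨J, hJ, hx⟩ := exists_right_smul_mem (a • unop x)
  refine map_eq_top_of_le (h J hJ) (fun j hj => ?_)
  obtain ⟨m, hm⟩ := hx j hj
  refine ⟨op m, trivial, unop_injective ?_⟩
  change unop x * toSymRing Fl Fr (unop a) * toSymRing Fl Fr (unop j) = toSymRing Fl Fr m
  rw [mul_toSymRing, mul_toSymRing, op_unop, op_unop, hm]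
  rfl

/-- Transport along the isomorphism lets the symmetric ring of quotients itself stand in for the
abstract perfect ring. -/
theorem IsPerfectPair.map_left (h : IsPerfectPair Fl Fr) {I : Ideal R} (hI : I ∈ Fl) :
    I.map (toSymRing Fl Fr) = ⊤ := by
  obtain ⟨S, _, f, hf⟩ := h
  obtain ⟨g, hg⟩ := hf.iso
  have e : toSymRing Fl Fr = (g : S →+* SymRing Fl Fr).comp f := RingHom.ext (fun r => (hg r).symm)
  rw [e, ← Ideal.map_map, (hf.left I).1 hI, Ideal.map_top]

theorem IsPerfectPair.map_right (h : IsPerfectPair Fl Fr) {J : Ideal Rᵐᵒᵖ} (hJ : J ∈ Fr) :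
    J.map (RingHom.op (toSymRing Fl Fr)) = ⊤ := by
  obtain ⟨S, _, f, hf⟩ := h
  obtain ⟨g, hg⟩ := hf.iso
  have e : RingHom.op (toSymRing Fl Fr) =
      (RingHom.op (g : S →+* SymRing Fl Fr)).comp (RingHom.op f) :=
    RingHom.ext (fun r => unop_injective (hg (unop r)).symm)
  rw [e, ← Ideal.map_map, (hf.right J).1 hJ, Ideal.map_top]

end

/-! ### Perfect subrings of the maximal symmetric ring of quotients -/

section

variable {R : Type u} [Ring R]

variable (R) in
/-- The maximal symmetric ring of quotients. -/
abbrev MaxSymRing : Type u := SymRing (lambekFilter R) (lambekFilter Rᵐᵒᵖ)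

variable (R) in
/-- The embedding of `R` into its maximal symmetric ring of quotients. -/
noncomputable abbrev toMaxSymRing : R →+* MaxSymRing R :=
  toSymRing (lambekFilter R) (lambekFilter Rᵐᵒᵖ)

variable {T : Subring (MaxSymRing R)} (hT : ∀ r, toMaxSymRing R r ∈ T)

theorem codRestrict_toMaxSymRing_injective :
    Function.Injective ((toMaxSymRing R).codRestrict T hT) := fun _ _ h =>
  toSymQ_injective (lambekFilter_isFaithful R) (congrArg Subtype.val h)

theorem op_codRestrict_toMaxSymRing_injective :
    Function.Injective (RingHom.op ((toMaxSymRing R).codRestrict T hT)) := fun _ _ h =>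
  unop_injective (codRestrict_toMaxSymRing_injective hT (congrArg unop h))

variable (hl : IsPerfectHom ((toMaxSymRing R).codRestrict T hT))
  (hr : IsPerfectHom (RingHom.op ((toMaxSymRing R).codRestrict T hT)))

/-- The left filter of a subring of the maximal symmetric ring of quotients. -/
noncomputable def leftFilter : GabrielFilter R :=
  perfectFilter _ (codRestrict_toMaxSymRing_injective hT) hl

/-- The right filter of a subring of the maximal symmetric ring of quotients. -/
noncomputable def rightFilter : GabrielFilter Rᵐᵒᵖ :=
  perfectFilter _ (op_codRestrict_toMaxSymRing_injective hT) hr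

theorem leftFilter_isFaithful : (leftFilter hT hl).IsFaithful := perfectFilter_isFaithful _ hl

theorem rightFilter_isFaithful : (rightFilter hT hr).IsFaithful := perfectFilter_isFaithful _ hr

/-- The symmetric ring of quotients of a perfect subring, inside the maximal one. -/
noncomputable def perfectSubringMap :
    SymRing (leftFilter hT hl) (rightFilter hT hr) →+* MaxSymRing R :=
  symRingMap (leftFilter_isFaithful hT hl).le_lambekFilter
    (rightFilter_isFaithful hT hr).le_lambekFilter

/-- The elements of `T` that multiply the image of `x` into `T` form a left ideal. It contains the
image of an ideal of the filter, hence contains `1`. -/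
theorem perfectSubringMap_mem (x : SymRing (leftFilter hT hl) (rightFilter hT hr)) :
    perfectSubringMap hT hl hr x ∈ T := by
  obtain ⟨I, hI, hx⟩ := exists_left_smul_mem x
  let N : Ideal T :=
    { carrier := {t | t * perfectSubringMap hT hl hr x ∈ T}
      zero_mem' := by simp
      add_mem' := fun {a b} ha hb => by
        have h := T.add_mem ha hb
        rwa [← add_mul] at h
      smul_mem' := fun c a ha => by
        have h := T.mul_mem c.2 ha
        rwa [← mul_assoc] at h }
  have hle : I.map ((toMaxSymRing R).codRestrict T hT) ≤ N :=
    Ideal.map_le_iff_le_comap.2 (fun i hi => by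
      obtain ⟨m, hm⟩ := hx i hi
      change toMaxSymRing R i * perfectSubringMap hT hl hr x ∈ T
      rw [toSymRing_mul, perfectSubringMap, ← symRingMap_left_smul, hm, symRingMap_toSymQ]
      exact hT m)
  rw [show I.map _ = ⊤ from hI] at hle
  have h1 : ((1 : T) : MaxSymRing R) * perfectSubringMap hT hl hr x ∈ T := hle trivial
  rwa [OneMemClass.coe_one, one_mul] at h1

/-- The left and the right denominators of `t` form ideals of the two filters, which is what the
descent `exists_symRingMap_eq` requires. -/
theorem exists_perfectSubringMap_eq (t : T) : ∃ x, perfectSubringMap hT hl hr x = t := by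
  have hI := hl t 1
  have hJ := hr (op t) 1
  refine exists_symRingMap_eq _ _ (lambekFilter_isFaithful R) hI hJ ?_ ?_
  · rintro i ⟨m, -, hm⟩
    rw [map_one, one_mul] at hm
    exact ⟨m, by rw [← toSymRing_mul]; exact congrArg Subtype.val hm⟩
  · rintro j ⟨m, -, hm⟩
    rw [map_one, one_mul] at hm
    refine ⟨unop m, ?_⟩
    obtain ⟨j, rfl⟩ := op_surjective j
    rw [← mul_toSymRing]
    exact congrArg Subtype.val (congrArg unop hm)

/-- The symmetric ring of quotients for the filters of `T` embeds into the maximal one with image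
exactly `T`. -/
theorem isPerfectPair_of_subring : IsPerfectPair (leftFilter hT hl) (rightFilter hT hr) := by
  refine ⟨T, inferInstance, (toMaxSymRing R).codRestrict T hT, fun _ => Iff.rfl, fun _ => Iff.rfl,
    ?_⟩
  let e := RingEquiv.ofBijective
    ((perfectSubringMap hT hl hr).codRestrict T (perfectSubringMap_mem hT hl hr))
    ⟨fun x y h => symRingMap_injective _ _ (lambekFilter_isFaithful R) (congrArg Subtype.val h),
      fun t => by
        obtain ⟨x, hx⟩ := exists_perfectSubringMap_eq hT hl hr t
        exact ⟨x, Subtype.ext hx⟩⟩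
  refine ⟨e.symm, fun r => (RingEquiv.symm_apply_eq e).2 (Subtype.ext ?_)⟩
  exact (symRingMap_toSymQ _ _ r).symm

end

/-! ### The total symmetric ring of quotients -/

section

variable {R : Type u} [Ring R]

variable (R) in
/-- The subring of the maximal symmetric ring of quotients generated by all perfect ones. -/
noncomputable def totalSubring : Subring (MaxSymRing R) :=
  Subring.closure (Set.range (toMaxSymRing R) ∪
    {x | ∃ (Gl : GabrielFilter R) (Gr : GabrielFilter Rᵐᵒᵖ) (hl : Gl ≤ lambekFilter R)
      (hr : Gr ≤ lambekFilter Rᵐᵒᵖ), IsPerfectPair Gl Gr ∧ x ∈ Set.range (symRingMap hl hr)})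

theorem toMaxSymRing_mem_totalSubring (r : R) : toMaxSymRing R r ∈ totalSubring R :=
  Subring.subset_closure (Or.inl ⟨r, rfl⟩)

variable (R) in
/-- The embedding of `R` into the total subring. -/
noncomputable abbrev toTotalSubring : R →+* totalSubring R :=
  (toMaxSymRing R).codRestrict (totalSubring R) toMaxSymRing_mem_totalSubring

/-- The map from a perfect symmetric ring of quotients into the total subring. -/
noncomputable def symRingToTotal {Gl : GabrielFilter R} {Gr : GabrielFilter Rᵐᵒᵖ}
    (h : IsPerfectPair Gl Gr) (hl : Gl ≤ lambekFilter R) (hr : Gr ≤ lambekFilter Rᵐᵒᵖ) :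
    SymRing Gl Gr →+* totalSubring R :=
  (symRingMap hl hr).codRestrict (totalSubring R)
    (fun x => Subring.subset_closure (Or.inr ⟨Gl, Gr, hl, hr, h, x, rfl⟩))

theorem symRingToTotal_comp {Gl : GabrielFilter R} {Gr : GabrielFilter Rᵐᵒᵖ}
    (h : IsPerfectPair Gl Gr) (hl : Gl ≤ lambekFilter R) (hr : Gr ≤ lambekFilter Rᵐᵒᵖ) :
    (symRingToTotal h hl hr).comp (toSymRing Gl Gr) = toTotalSubring R :=
  RingHom.ext (fun r => Subtype.ext (symRingMap_toSymQ hl hr r))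

theorem op_symRingToTotal_comp {Gl : GabrielFilter R} {Gr : GabrielFilter Rᵐᵒᵖ}
    (h : IsPerfectPair Gl Gr) (hl : Gl ≤ lambekFilter R) (hr : Gr ≤ lambekFilter Rᵐᵒᵖ) :
    (RingHom.op (symRingToTotal h hl hr)).comp (RingHom.op (toSymRing Gl Gr)) =
      RingHom.op (toTotalSubring R) :=
  congrArg RingHom.op (symRingToTotal_comp h hl hr)

/-- The generation property restated for subrings of `totalSubring R` itself, so that it applies to
the subring of elements with enough denominators. -/
theorem eq_top_of_generators {G : Subring (totalSubring R)}
    (h : ∀ r, toTotalSubring R r ∈ G)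
    (h' : ∀ (Gl : GabrielFilter R) (Gr : GabrielFilter Rᵐᵒᵖ) (hG : IsPerfectPair Gl Gr)
      (hl : Gl ≤ lambekFilter R) (hr : Gr ≤ lambekFilter Rᵐᵒᵖ) (x : SymRing Gl Gr),
      symRingToTotal hG hl hr x ∈ G) : G = ⊤ := by
  have hle : totalSubring R ≤ G.map (totalSubring R).subtype := by
    refine Subring.closure_le.2 ?_
    rintro x (⟨r, rfl⟩ | ⟨Gl, Gr, hl, hr, hG, y, rfl⟩)
    · exact ⟨_, h r, rfl⟩
    · exact ⟨_, h' Gl Gr hG hl hr y, rfl⟩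
  refine top_unique (fun t _ => ?_)
  obtain ⟨g, hg, hgt⟩ := hle t.2
  rwa [← Subtype.ext hgt]

/-- The elements with enough denominators form a subring. It contains the image of every perfect
ring of quotients, because denominators survive ring homomorphisms. -/
theorem isPerfectHom_toTotalSubring : IsPerfectHom (toTotalSubring R) := by
  have h : denominatorSubring (toTotalSubring R) = ⊤ := by
    refine eq_top_of_generators (fun r => hasDenominators_of_mem (I := ⊤) trivial)
      (fun Gl Gr hG hl hr y => ?_)
    have h' := (isPerfectHom_toSymRing (fun I hI => hG.map_left hI) y).comp
      (symRingToTotal hG hl hr)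
    rwa [symRingToTotal_comp] at h'
  intro t
  have ht : t ∈ denominatorSubring (toTotalSubring R) := h ▸ trivial
  exact ht

theorem isPerfectHom_op_toTotalSubring : IsPerfectHom (RingHom.op (toTotalSubring R)) := by
  have h : (denominatorSubring (RingHom.op (toTotalSubring R))).unop = ⊤ := by
    refine eq_top_of_generators (fun r => hasDenominators_of_mem (I := ⊤) (b := op r) trivial)
      (fun Gl Gr hG hl hr y => ?_)
    have h' := (isPerfectHom_op_toSymRing (fun J hJ => hG.map_right hJ) (op y)).comp
      (RingHom.op (symRingToTotal hG hl hr))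
    rwa [op_symRingToTotal_comp] at h'
  intro t
  have ht : unop t ∈ (denominatorSubring (RingHom.op (toTotalSubring R))).unop := h ▸ trivial
  exact ht

variable (R) in
/-- The total symmetric ring of quotients exists. -/
theorem exists_isTotalPair :
    ∃ (Tl : GabrielFilter R) (Tr : GabrielFilter Rᵐᵒᵖ), IsTotalPair Tl Tr := by
  refine ⟨leftFilter _ isPerfectHom_toTotalSubring, rightFilter _ isPerfectHom_op_toTotalSubring,
    isPerfectPair_of_subring _ _ _, leftFilter_isFaithful _ _, rightFilter_isFaithful _ _,
    fun Gl Gr h hl hr => ⟨fun I hI => ?_, fun J hJ => ?_⟩⟩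
  -- An ideal that generates a perfect ring of quotients also generates the total subring, into
  -- which that ring maps.
  · change I.map (toTotalSubring R) = ⊤
    rw [← symRingToTotal_comp h hl.le_lambekFilter hr.le_lambekFilter, ← Ideal.map_map,
      h.map_left hI, Ideal.map_top]
  · change J.map (RingHom.op (toTotalSubring R)) = ⊤
    rw [← op_symRingToTotal_comp h hl.le_lambekFilter hr.le_lambekFilter, ← Ideal.map_map,
      h.map_right hJ, Ideal.map_top]

end

/-! ### The classical ring of quotients -/

section

variable {A : Type u} [Ring A]

/-- This is the Ore condition: for every `a` there is a regular `s` with `s * a ∈ A t`. -/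
theorem span_singleton_mem_classicalFilter [OreLocalization.OreSet A⁰] {t : A} (ht : t ∈ A⁰) :
    Ideal.span {t} ∈ classicalFilter A := fun a =>
  ⟨OreLocalization.oreDenom a (⟨t, ht⟩ : A⁰), SetLike.coe_mem _, Ideal.mem_span_singleton'.2
    ⟨OreLocalization.oreNum a (⟨t, ht⟩ : A⁰),
      (OreLocalization.ore_eq a (⟨t, ht⟩ : A⁰)).symm⟩⟩

/-- The classical filter is the filter of a ring of left fractions. -/
theorem mem_classicalFilter_iff_map_eq_top [OreLocalization.OreSet A⁰] {S : Type v} [Ring S]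
    {f : A →+* S} (hinj : Function.Injective f) (hu : ∀ t ∈ A⁰, IsUnit (f t))
    (hs : ∀ s, ∃ t ∈ A⁰, ∃ a, f t * s = f a) {I : Ideal A} :
    I ∈ classicalFilter A ↔ I.map f = ⊤ := by
  constructor
  · intro h
    obtain ⟨t, ht, hI⟩ := h 1
    rw [mul_one] at hI
    exact Ideal.eq_top_of_isUnit_mem _ (Ideal.mem_map_of_mem f hI) (hu t ht)
  · intro h
    -- Every element of `S f(I)` is a single left fraction with numerator in `I`.
    have key : ∀ y ∈ I.map f, ∃ t ∈ A⁰, ∃ i ∈ I, f t * y = f i := by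
      intro y hy
      induction hy using Submodule.span_induction with
      | mem y hy =>
        obtain ⟨i, hi, rfl⟩ := hy
        exact ⟨1, one_mem _, i, hi, by rw [map_one, one_mul]⟩
      | zero => exact ⟨1, one_mem _, 0, I.zero_mem, by simp⟩
      | add y z _ _ hy hz =>
        obtain ⟨t, ht, i, hi, h⟩ := hy
        obtain ⟨s, hs, j, hj, h'⟩ := hz
        -- The Ore condition yields the common denominator `u * s = v * t`.
        obtain ⟨u, hu, hut⟩ := span_singleton_mem_classicalFilter ht s
        obtain ⟨v, hv⟩ := Ideal.mem_span_singleton'.1 hut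
        refine ⟨u * s, mul_mem hu hs, v * i + u * j,
          I.add_mem (I.mul_mem_left v hi) (I.mul_mem_left u hj), ?_⟩
        rw [mul_add, map_add, map_mul f v, map_mul f u j, ← h, ← h', ← mul_assoc, ← map_mul, hv,
          map_mul f u s, mul_assoc, mul_assoc]
      | smul s y _ hy =>
        obtain ⟨t, ht, i, hi, h⟩ := hy
        obtain ⟨w, hw⟩ := hu t ht
        -- Since `y = f(t)⁻¹ f(i)`, rewriting `s f(t)⁻¹` as `f(v)⁻¹ f(a)` gives `s y = f(v)⁻¹ f(a
        -- i)`, provided `f(v)` is inverted; the code keeps the form `f(v) s y = f(a i)`.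
        obtain ⟨v, hv, a, ha⟩ := hs (s * ↑w⁻¹)
        refine ⟨v, hv, a * i, I.mul_mem_left a hi, ?_⟩
        rw [map_mul, ← ha, ← h, ← hw, smul_eq_mul]
        simp only [mul_assoc, Units.inv_mul_cancel_left]
    -- For `y = 1` the fraction reads `f t = f i`, so the regular element `t` itself lies in `I`.
    obtain ⟨t, ht, i, hi, h1⟩ := key 1 (h ▸ trivial)
    rw [mul_one] at h1
    rw [← hinj h1] at hi
    exact (classicalFilter A).mem_of_le (span_singleton_mem_classicalFilter ht)
      ((Ideal.span_singleton_le_iff_mem I).2 hi)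

end

section

variable {R : Type u} [Ring R]

theorem op_mem_nonZeroDivisors {t : R} (ht : t ∈ R⁰) : op t ∈ Rᵐᵒᵖ⁰ :=
  ⟨fun x hx => unop_injective (ht.2 (unop x) (congrArg unop hx)),
    fun x hx => unop_injective (ht.1 (unop x) (congrArg unop hx))⟩

theorem unop_mem_nonZeroDivisors {t : Rᵐᵒᵖ} (ht : t ∈ Rᵐᵒᵖ⁰) : unop t ∈ R⁰ :=
  ⟨fun x hx => op_injective (ht.2 (op x) (congrArg op hx)),
    fun x hx => op_injective (ht.1 (op x) (congrArg op hx))⟩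

variable (R) in
/-- The classical symmetric ring of quotients. -/
abbrev ClassicalSymRing : Type u := SymRing (classicalFilter R) (classicalFilter Rᵐᵒᵖ)

variable (R) in
/-- The embedding of `R` into its classical symmetric ring of quotients. -/
noncomputable abbrev toClassicalSymRing : R →+* ClassicalSymRing R :=
  toSymRing (classicalFilter R) (classicalFilter Rᵐᵒᵖ)

variable (R) in
theorem toClassicalSymRing_injective : Function.Injective (toClassicalSymRing R) :=
  toSymQ_injective (classicalFilter_isFaithful R)

theorem exists_mul_eq_toClassicalSymRing (x : ClassicalSymRing R) :
    ∃ t ∈ R⁰, ∃ a, toClassicalSymRing R t * x = toClassicalSymRing R a := by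
  obtain ⟨I, hI, hx⟩ := exists_left_smul_mem x
  obtain ⟨t, ht, htI⟩ := hI 1
  rw [mul_one] at htI
  obtain ⟨m, hm⟩ := hx t htI
  exact ⟨t, ht, m, by rw [toSymRing_mul, hm]; rfl⟩

theorem exists_op_mul_eq_toClassicalSymRing (x : (ClassicalSymRing R)ᵐᵒᵖ) :
    ∃ t ∈ Rᵐᵒᵖ⁰, ∃ a, RingHom.op (toClassicalSymRing R) t * x =
      RingHom.op (toClassicalSymRing R) a := by
  obtain ⟨J, hJ, hx⟩ := exists_right_smul_mem (unop x)
  obtain ⟨t, ht, htJ⟩ := hJ 1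
  rw [mul_one] at htJ
  obtain ⟨m, hm⟩ := hx t htJ
  refine ⟨t, ht, op m, unop_injective ?_⟩
  change unop x * toSymRing _ _ (unop t) = toSymRing _ _ m
  rw [mul_toSymRing, op_unop, hm]
  rfl

variable [OreLocalization.OreSet R⁰] [OreLocalization.OreSet (Rᵐᵒᵖ)⁰]

/-- The inverse of `t` is the element given by the maps `a t ↦ a` on `R t` and `t a ↦ a` on `t R`.
They are well defined as `t` is regular, and compatible because `a (t b) = (a t) b`. The Ore
conditions put `R t` and `t R` into the filters. -/
theorem isUnit_toClassicalSymRing {t : R} (ht : t ∈ R⁰) : IsUnit (toClassicalSymRing R t) := by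
  classical
  let q := toSymQ (classicalFilter R) (classicalFilter Rᵐᵒᵖ) R
  let f : R → ClassicalSymRing R := fun i => if h : ∃ a, a * t = i then q h.choose else 0
  let g : Rᵐᵒᵖ → ClassicalSymRing R := fun j =>
    if h : ∃ a, t * a = unop j then q h.choose else 0
  have hf : ∀ a, f (a * t) = q a := by
    intro a
    have h : ∃ b, b * t = a * t := ⟨a, rfl⟩
    simp only [f, dif_pos h]
    rw [(mul_cancel_right_mem_nonZeroDivisors ht).1 h.choose_spec]
  have hg : ∀ a, g (op (t * a)) = q a := by
    intro a
    have h : ∃ b, t * b = unop (op (t * a)) := ⟨a, rfl⟩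
    simp only [g, dif_pos h]
    rw [(mul_cancel_left_mem_nonZeroDivisors ht).1 h.choose_spec]
  have hJ : ∀ j ∈ Ideal.span {op t}, ∃ b, op (t * b) = j := by
    intro j hj
    obtain ⟨b, rfl⟩ := Ideal.mem_span_singleton'.1 hj
    exact ⟨unop b, rfl⟩
  have hI : ∀ i ∈ Ideal.span {t}, ∃ a, a * t = i := fun i hi => Ideal.mem_span_singleton'.1 hi
  obtain ⟨x, hx, hx'⟩ := exists_of_pair (span_singleton_mem_classicalFilter ht)
    (span_singleton_mem_classicalFilter (op_mem_nonZeroDivisors ht)) f g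
    (by
      intro i hi j hj
      obtain ⟨a, rfl⟩ := hI i hi
      obtain ⟨b, rfl⟩ := hI j hj
      rw [← add_mul, hf, hf, hf, map_add])
    (by
      intro r i hi
      obtain ⟨a, rfl⟩ := hI i hi
      rw [← mul_assoc, hf, hf, ← toSymQ_left_smul]
      rfl)
    (by
      intro i hi j hj
      obtain ⟨a, rfl⟩ := hJ i hi
      obtain ⟨b, rfl⟩ := hJ j hj
      rw [← op_add, ← mul_add, hg, hg, hg, map_add])
    (by
      intro r i hi
      obtain ⟨a, rfl⟩ := hJ i hi
      obtain ⟨r, rfl⟩ := op_surjective r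
      rw [← op_mul, mul_assoc, hg, hg, ← toSymQ_right_smul]
      rfl)
    (by
      intro i hi j hj
      obtain ⟨a, rfl⟩ := hI i hi
      obtain ⟨b, rfl⟩ := hJ j hj
      rw [hf, hg, ← toSymQ_right_smul, ← toSymQ_left_smul, op_smul_eq_mul, smul_eq_mul, mul_assoc])
  have h1 := hx (1 * t) (Ideal.mem_span_singleton'.2 ⟨1, rfl⟩)
  have h2 := hx' (op (t * 1)) (Ideal.mem_span_singleton'.2 ⟨1, rfl⟩)
  rw [hf, one_mul] at h1
  rw [hg, mul_one] at h2
  exact ⟨⟨_, x, (toSymRing_mul t x).trans h1, (mul_toSymRing t x).trans h2⟩, rfl⟩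

theorem isUnit_op_toClassicalSymRing {t : Rᵐᵒᵖ} (ht : t ∈ Rᵐᵒᵖ⁰) :
    IsUnit (RingHom.op (toClassicalSymRing R) t) :=
  (isUnit_toClassicalSymRing (unop_mem_nonZeroDivisors ht)).op

variable (R) in
-- Fractions describe the ring on both sides, so each classical filter consists of the ideals that
-- generate it. This places the classical pair below the total one.
theorem isPerfectPair_classicalFilter :
    IsPerfectPair (classicalFilter R) (classicalFilter Rᵐᵒᵖ) :=
  ⟨ClassicalSymRing R, inferInstance, toClassicalSymRing R,
    fun _ => mem_classicalFilter_iff_map_eq_top (toClassicalSymRing_injective R)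
      (fun _ => isUnit_toClassicalSymRing) exists_mul_eq_toClassicalSymRing,
    fun _ => mem_classicalFilter_iff_map_eq_top
      (fun _ _ h => unop_injective (toClassicalSymRing_injective R (congrArg unop h)))
      (fun _ => isUnit_op_toClassicalSymRing) exists_op_mul_eq_toClassicalSymRing,
    ⟨RingEquiv.refl _, fun _ => rfl⟩⟩

variable (R) in
/-- The classical symmetric ring of quotients is the Ore localization at the regular elements. -/
theorem exists_oreLocalization_ringEquiv :
    ∃ e : OreLocalization R⁰ R ≃+* ClassicalSymRing R,
      ∀ r : R, e (OreLocalization.numeratorRingHom r) = toClassicalSymRing R r := by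
  let fS : R⁰ →* (ClassicalSymRing R)ˣ :=
    IsUnit.liftRight ((toClassicalSymRing R : R →* ClassicalSymRing R).comp R⁰.subtype)
      (fun t => isUnit_toClassicalSymRing t.2)
  have hfS : ∀ t : R⁰, toClassicalSymRing R t = fS t := fun t => rfl
  let φ := OreLocalization.universalHom (toClassicalSymRing R) fS hfS
  refine ⟨RingEquiv.ofBijective φ ⟨(injective_iff_map_eq_zero _).2 (fun x hx => ?_), fun y => ?_⟩,
    fun r => OreLocalization.universalHom_commutes _ fS hfS⟩
  -- The fraction `s⁻¹ r` maps to `q(s)⁻¹ q(r)`, which vanishes only if `q(r) = 0`, that is, `r =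
  -- 0`.
  · induction x using OreLocalization.ind with
    | _ r s =>
      rw [OreLocalization.universalHom_apply, Units.mul_right_eq_zero] at hx
      rw [(toClassicalSymRing_injective R) (hx.trans (map_zero _).symm),
        OreLocalization.zero_oreDiv]
  · obtain ⟨t, ht, a, h⟩ := exists_mul_eq_toClassicalSymRing y
    refine ⟨OreLocalization.oreDiv a (⟨t, ht⟩ : R⁰), ?_⟩
    rw [OreLocalization.universalHom_apply, Units.inv_mul_eq_iff_eq_mul, ← hfS, h]

end

theorem mainTheorem9 {R : Type u} [Ring R] (δ : R →+ R) (hδ : IsRingDerivation δ)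
    {M : Type v} [AddCommGroup M] [Module R M] [Module Rᵐᵒᵖ M] [SMulCommClass R Rᵐᵒᵖ M]
    (d : M →+ M) (hd : IsBimoduleDerivation δ d) :
    ∃ (Tl : GabrielFilter R) (Tr : GabrielFilter Rᵐᵒᵖ), IsTotalPair Tl Tr ∧
      -- (1) rings of quotients for faithful symmetric theories, and the total one
      ((∀ (Fl : GabrielFilter R) (Fr : GabrielFilter Rᵐᵒᵖ), Fl.IsFaithful → Fr.IsFaithful →
          RingExtensionsAgree Fl Fr (lambekFilter R) (lambekFilter Rᵐᵒᵖ) δ) ∧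
        RingExtensionsAgree Tl Tr (lambekFilter R) (lambekFilter Rᵐᵒᵖ) δ) ∧
      -- (2) modules of quotients for differential faithful symmetric theories
      ((∀ (Fl : GabrielFilter R) (Fr : GabrielFilter Rᵐᵒᵖ), Fl.IsFaithful → Fr.IsFaithful →
          IsDifferential (symFilter Fl Fr) →
          ModuleExtensionsAgree Fl Fr (lambekFilter R) (lambekFilter Rᵐᵒᵖ) δ d) ∧
        ModuleExtensionsAgree Tl Tr (lambekFilter R) (lambekFilter Rᵐᵒᵖ) δ d) ∧
      -- (3) the classical ring of quotients of a left and right Ore ring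
      (∀ (_ : OreLocalization.OreSet R⁰) (_ : OreLocalization.OreSet (Rᵐᵒᵖ)⁰),
        (∃ e : OreLocalization R⁰ R ≃+* SymRing (classicalFilter R) (classicalFilter Rᵐᵒᵖ),
          ∀ r : R, e (OreLocalization.numeratorRingHom r) =
            toSymRing (classicalFilter R) (classicalFilter Rᵐᵒᵖ) r) ∧
        RingExtensionsAgree (classicalFilter R) (classicalFilter Rᵐᵒᵖ)
          (lambekFilter R) (lambekFilter Rᵐᵒᵖ) δ ∧
        RingExtensionsAgree (classicalFilter R) (classicalFilter Rᵐᵒᵖ) Tl Tr δ) ∧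
      -- (4) the symmetric Goldie ring of quotients
      (RingExtensionsAgree (lambekFilter R) (lambekFilter Rᵐᵒᵖ)
          (goldieFilter R) (goldieFilter Rᵐᵒᵖ) δ ∧
        ∀ (Fl : GabrielFilter R) (Fr : GabrielFilter Rᵐᵒᵖ), Fl.IsFaithful → Fr.IsFaithful →
          RingExtensionsAgree Fl Fr (goldieFilter R) (goldieFilter Rᵐᵒᵖ) δ) := by
  obtain ⟨Tl, Tr, hT⟩ := exists_isTotalPair R
  have hTl := hT.left_faithful.le_lambekFilter
  have hTr := hT.right_faithful.le_lambekFilter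
  have hGl := lambekFilter_le_goldieFilter R
  have hGr := lambekFilter_le_goldieFilter Rᵐᵒᵖ
  refine ⟨Tl, Tr, hT, ⟨fun Fl Fr hl hr => ?_, ?_⟩, ⟨fun Fl Fr hl hr _ => ?_, ?_⟩,
    fun _ _ => ⟨exists_oreLocalization_ringEquiv R, ?_, ?_⟩, ?_, fun Fl Fr hl hr => ?_⟩
  · exact ringExtensionsAgree_of_le (symFilter_mono hl.le_lambekFilter hr.le_lambekFilter) hδ
  · exact ringExtensionsAgree_of_le (symFilter_mono hTl hTr) hδ
  · exact moduleExtensionsAgree_of_le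
      (symFilter_mono hl.le_lambekFilter hr.le_lambekFilter) hδ hd
  · exact moduleExtensionsAgree_of_le (symFilter_mono hTl hTr) hδ hd
  · exact ringExtensionsAgree_of_le
      (symFilter_mono (classicalFilter_isFaithful R).le_lambekFilter
        (classicalFilter_isFaithful Rᵐᵒᵖ).le_lambekFilter) hδ
  -- The classical pair is perfect and faithful, hence lies below the largest such pair.
  · obtain ⟨hl, hr⟩ := hT.largest _ _ (isPerfectPair_classicalFilter R)
      (classicalFilter_isFaithful R) (classicalFilter_isFaithful Rᵐᵒᵖ)
    exact ringExtensionsAgree_of_le (symFilter_mono hl hr) hδ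
  · exact ringExtensionsAgree_of_le (symFilter_mono hGl hGr) hδ
  · exact ringExtensionsAgree_of_le
      (symFilter_mono (fun I hI => hGl I (hl.le_lambekFilter I hI))
        (fun J hJ => hGr J (hr.le_lambekFilter J hJ))) hδ
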